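/- Let $\lambda>0$, $0<\mu_b<\mu_g$ and $p,q\in(0,1)$. Status update packets arrive at a server according to a Poisson process of rate $\lambda$ started at time $0$. The server is initially idle and blocking: a packet that arrives while the server is idle enters service immediately, and a packet that arrives while the server is busy is discarded. Let $X_j\in\{b,g\}$ be the state of the server during the $j$-th service. $(X_j)_{j\ge 0}$ is a Markov chain, with arbitrary initial law, that moves from $b$ to $g$ with probability $p$ and from $g$ to $b$ with probability $q$. Given this chain, the service times $S_j$ are independent, $S_j$ being exponential with rate $\mu_{X_j}$, and $(X_j,S_j)_{j}$ is independent of the arrivals. Let $T_j$ be the arrival time of the $j$-th packet that enters service; this packet is delivered to a monitor at time $T_j+S_j$. The age is $\Delta(t)=t-u(t)$, where $u(t)$ is the arrival time of the most recent packet delivered up to time $t$, and $u(t)=u_0$ for a fixed $u_0\le 0$ before the first delivery. Let $Y_j=T_{j+1}-T_j$, and let $Q_j$ be the area of the part of the region between the time axis and the graph of $\Delta$ that lies between the two lines of slope one through the points $(T_j,0)$ and $(T_{j+1},0)$ (a trapezoid that ends at the delivery time $T_{j+1}+S_{j+1}$). Let $S_b\sim\mathrm{Exp}(\mu_b)$,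 $S_g\sim\mathrm{Exp}(\mu_g)$ and $Z\sim\mathrm{Exp}(\lambda)$ with $Z$ independent of $S_b$ and of $S_g$, and put $$E[\bar S]=pE[S_g]+(1-p)E[S_b],\qquad E[\bar{\bar S}]=qE[S_b]+(1-q)E[S_g],$$ $$m_b=\tfrac12E[(S_b+Z)^2]+(E[S_b]+E[Z])E[\bar S],\qquad m_g=\tfrac12E[(S_g+Z)^2]+(E[S_g]+E[Z])E[\bar{\bar S}],$$ $$\ell_b=E[S_b]+E[Z],\qquad \ell_g=E[S_g]+E[Z],\qquad \Delta=\frac{q\,m_b+p\,m_g}{q\,\ell_b+p\,\ell_g}.$$ Then: 1. Almost surely, the age is integrable on every bounded interval $[0,\tau]$ and $\displaystyle\lim_{\tau\to\infty}\frac1\tau\int_0^\tau\Delta(t)\,dt=\Delta$. 2. Almost surely, $\displaystyle\lim_{n\to\infty}\frac{\frac1n\sum_{j<n}Q_j}{\frac1n\sum_{j<n}Y_j}=\Delta$. 3. All $Q_j$ and $Y_j$ are integrable. For every $j$ and every $s\in\{b,g\}$ with $P(X_j=s)>0$, $$\sum_{s'\in\{b,g\}}P(s\to s')\,E[Q_j\mid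 X_j=s,X_{j+1}=s']=m_s,\qquad E[Y_j\mid X_j=s,X_{j+1}=s']=\ell_s\quad(s'\in\{b,g\}),$$ where $P(s\to s')$ is the transition probability. That is, $E[Q_s]=m_s$ and $E[Y_s]=\ell_s$ are the conditional means of the area and of the length of a cycle, given that the server is in state $s$ in that cycle. 4. If the chain is stationary, i.e. $P(X_0=b)=\frac q{p+q}$ and $P(X_0=g)=\frac p{p+q}$, then $E[Q_j]/E[Y_j]=\Delta$ for every $j$. -/

import Mathlib

open MeasureTheory ProbabilityTheory Filter Topology

namespace GilbertElliot

/-- The two states of the server. -/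
inductive ServerState where
  | bad
  | good

instance : MeasurableSpace ServerState := ⊤

/-- Service rate in each state. -/
def serviceRate (μb μg : ℝ) : ServerState → ℝ
  | .bad => μb
  | .good => μg

/-- Transition matrix: `p` is the probability of bad → good, `q` that of good → bad. -/
def transition (p q : ℝ) : ServerState → ServerState → ℝ
  | .bad, .bad => 1 - p
  | .bad, .good => p
  | .good, .bad => q
  | .good, .good => 1 - q

/-! ### Sample paths

A sample path is given by the interarrival times `A n` of all packets at the server and by the
service times `S j` of the packets that enter service. Packets are numbered from `0`. -/

/-- Arrival time of packet number `n`. -/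
def arrivalTime (A : ℕ → ℝ) (n : ℕ) : ℝ := ∑ i ∈ Finset.range (n + 1), A i

/-- Blocking policy: `entryIndex A S j` is the number of the packet that is the `j`-th one to enter
service. The server is initially idle, so packet `0` enters service. While a packet is in service
all arrivals are discarded; the first packet that arrives after the completion of that service is
the next one to enter service. -/
noncomputable def entryIndex (A S : ℕ → ℝ) : ℕ → ℕ
  | 0 => 0
  | j + 1 => sInf {n | arrivalTime A (entryIndex A S j) + S j < arrivalTime A n}

/-- Arrival time (equivalently: time stamp) of the `j`-th successful packet. -/
noncomputable def entryTime (A S : ℕ → ℝ) (j : ℕ) : ℝ := arrivalTime A (entryIndex A S j)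

/-- Time at which the `j`-th successful packet is delivered to the monitor. -/
noncomputable def deliveryTime (A S : ℕ → ℝ) (j : ℕ) : ℝ := entryTime A S j + S j

/-- Length of the `j`-th update cycle: time between consecutive successful arrivals. -/
noncomputable def cycleLength (A S : ℕ → ℝ) (j : ℕ) : ℝ := entryTime A S (j + 1) - entryTime A S j

/-- Time stamp of the freshest update present at the monitor at time `t`; `u₀` is the time stamp of
the update that the monitor holds initially. -/
noncomputable def freshestStamp (u₀ : ℝ) (A S : ℕ → ℝ) (t : ℝ) : ℝ :=
  sSup (insert u₀ {u | ∃ j, deliveryTime A S j ≤ t ∧ u = entryTime A S j})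

/-- Instantaneous age at the monitor. -/
noncomputable def age (u₀ : ℝ) (A S : ℕ → ℝ) (t : ℝ) : ℝ := t - freshestStamp u₀ A S t

/-- Area under the age curve that belongs to update cycle `j`: the area of the part of the region
below the graph of the age that lies between the lines of slope one through `(entryTime j, 0)` and
`(entryTime (j + 1), 0)`. This part ends at the delivery of the successful packet `j + 1`. -/
noncomputable def cycleArea (u₀ : ℝ) (A S : ℕ → ℝ) (j : ℕ) : ℝ :=
  ∫ t in (entryTime A S j)..(deliveryTime A S (j + 1)),
    (min (age u₀ A S t) (t - entryTime A S j) - max 0 (t - entryTime A S (j + 1)))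

/-! ### The stochastic model -/

/-- Poisson arrivals of rate `lam` (interarrival times `A`), independent of the event-triggered
Gilbert-Elliot service process: `X j` is the state of the server during the `j`-th service, a Markov
chain with transition matrix `transition p q` and arbitrary initial law; given the chain, the
service times `S j` are independent and exponential with rate given by the state `X j`. -/
structure IsModel {Ω : Type*} [MeasurableSpace Ω] (P : Measure Ω) (lam μb μg p q : ℝ)
    (A : ℕ → Ω → ℝ) (X : ℕ → Ω → ServerState) (S : ℕ → Ω → ℝ) : Prop where
  measurable_A : ∀ n, Measurable (A n)
  measurable_X : ∀ j, Measurable (X j)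
  measurable_S : ∀ j, Measurable (S j)
  arrivals_law : ∀ n, P.map (A n) = expMeasure lam
  arrivals_indep : iIndepFun A P
  chain : ∀ (n : ℕ) (s : ℕ → ServerState),
    P {ω | ∀ i ≤ n + 1, X i ω = s i} =
      P {ω | ∀ i ≤ n, X i ω = s i} * ENNReal.ofReal (transition p q (s n) (s (n + 1)))
  service : ∀ (n : ℕ) (s : ℕ → ServerState) (B : ℕ → Set ℝ), (∀ i, MeasurableSet (B i)) →
    P {ω | ∀ i ≤ n, X i ω = s i ∧ S i ω ∈ B i} =
      P {ω | ∀ i ≤ n, X i ω = s i} *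
        ∏ i ∈ Finset.range (n + 1), expMeasure (serviceRate μb μg (s i)) (B i)
  arrivals_indep_service :
    IndepFun (fun ω n => A n ω) (fun ω j => (X j ω, S j ω)) P

/-! ### Moment expressions -/

/-- Mean of an exponential random variable of rate `r`. -/
noncomputable def expMean (r : ℝ) : ℝ := ∫ x, x ∂(expMeasure r)

/-- `E[(S + Z)²]` for independent `S ~ Exp(μ)` and `Z ~ Exp(lam)`. -/
noncomputable def sumSecondMoment (μ lam : ℝ) : ℝ :=
  ∫ x : ℝ × ℝ, (x.1 + x.2) ^ 2 ∂((expMeasure μ).prod (expMeasure lam))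

/-- Mean service time of the next packet, given that the present packet is served in state `s`. -/
noncomputable def nextServiceMean (μb μg p q : ℝ) : ServerState → ℝ
  | .bad => p * expMean μg + (1 - p) * expMean μb
  | .good => q * expMean μb + (1 - q) * expMean μg

/-- `E[Q_b]` and `E[Q_g]`. -/
noncomputable def meanArea (lam μb μg p q : ℝ) (s : ServerState) : ℝ :=
  1 / 2 * sumSecondMoment (serviceRate μb μg s) lam +
    (expMean (serviceRate μb μg s) + expMean lam) * nextServiceMean μb μg p q s

/-- `E[Y_b]` and `E[Y_g]`. -/
noncomputable def meanLength (lam μb μg : ℝ) (s : ServerState) : ℝ :=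
  expMean (serviceRate μb μg s) + expMean lam

/-- The average age `(q E[Q_b] + p E[Q_g]) / (q E[Y_b] + p E[Y_g])`. -/
noncomputable def averageAge (lam μb μg p q : ℝ) : ℝ :=
  (q * meanArea lam μb μg p q .bad + p * meanArea lam μb μg p q .good) /
    (q * meanLength lam μb μg .bad + p * meanLength lam μb μg .good)

end GilbertElliot

/-! ### The exponential distribution: memorylessness and moments -/

namespace GilbertElliot

/-! Cut time at the entry times. A cycle is a service time S_j followed by an idle period I_j, so
Y_j = S_j + I_j. On every path with positive service times and with positive interarrival times of
divergent sum, the trapezoid is a difference of two triangles, and Q_j = Y_j²/2 + Y_j S_{j+1}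
(`cycleArea_eq`). Everything reduces to the joint law of the states X_j and of the pairs W_j = (S_j,
I_j).

This law comes from memorylessness. For fixed service times, the overshoot of the arrivals over the
end of a service, followed by the later interarrival times, is again a sequence of independent
Exp(λ) variables (`expSeq_restart`). By induction the I_j are independent Exp(λ) variables
(`expSeq_idleTime`), and Fubini makes them independent of the service process. Hence, given X_n, the
pair (X_{n+1}, W_{n+1}) is independent of the history up to cycle n and has an explicit law
(`map_history_cycleTimes`).

The limits use neither renewal theory nor a general ergodic theorem. A function of two consecutive
cycles with conditional mean zero given the first is orthogonal to the past, and orthogonal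
variables with bounded second moments have averages tending to 0 almost surely
(`tendsto_average_of_orthogonal`). This is applied to the indicator of the good state minus its
transition probability, which gives the state frequencies q/(p+q) and p/(p+q); to a function of a
cycle minus its mean given the state; and to Y_n times the centered next service time, which
accounts for the term Y_n S_{n+1} of the area. Together they give the averages of Q_j and Y_j.

For the time average, the integral of the age up to the n-th delivery is the sum of the first n
areas plus S_n²/2 plus a term independent of n. Here S_n² = o(n), and monotonicity of the integral
covers the times between deliveries. The conditional and stationary means follow from the product
law of two consecutive cycles given their states (`map_cycleTimes_pair`). -/

theorem expMeasure_apply {r : ℝ} (C : Set ℝ) (hC : MeasurableSet C) :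
    expMeasure r C = ∫⁻ x, C.indicator (exponentialPDF r) x := by
  rw [expMeasure, gammaMeasure, withDensity_apply _ hC, ← lintegral_indicator hC]
  rfl

theorem measurable_exponentialPDF (r : ℝ) : Measurable (exponentialPDF r) :=
  (measurable_exponentialPDFReal r).ennreal_ofReal

/-- The exponential distribution is memoryless. -/
theorem expMeasure_memoryless {r s : ℝ} (hr : 0 < r) (hs : 0 ≤ s) {C : Set ℝ}
    (hC : MeasurableSet C) :
    expMeasure r {x | s < x ∧ x - s ∈ C} = expMeasure r (Set.Ioi s) * expMeasure r C := by
  have key : ∀ D : Set ℝ, MeasurableSet D → expMeasure r {x | s < x ∧ x - s ∈ D} =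
      ENNReal.ofReal (Real.exp (-(r * s))) * expMeasure r D := by
    intro D hD
    have hm : MeasurableSet {x | s < x ∧ x - s ∈ D} :=
      measurableSet_Ioi.inter (hD.preimage (measurable_id.sub_const s))
    rw [expMeasure_apply _ hm, expMeasure_apply _ hD, ← lintegral_const_mul _
      ((measurable_exponentialPDF r).indicator hD), ← lintegral_add_right_eq_self _ s]
    refine lintegral_congr_ae ?_
    -- After the shift by `s`, the strict inequality excludes x = 0, where the density on the right
    -- is nonzero; this single point is discarded.
    have h0 : ∀ᵐ x : ℝ, x ≠ 0 := by simp [ae_iff]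
    filter_upwards [h0] with x hx
    by_cases hxD : x ∈ D
    · rcases lt_or_gt_of_ne hx with h | h
      · simp [Set.indicator, hxD, not_lt.2 h.le, exponentialPDF_of_neg h]
      · simp only [Set.indicator, Set.mem_ofPred_eq, lt_add_iff_pos_left, h, add_sub_cancel_right,
          hxD, and_self, if_true]
        rw [exponentialPDF_of_nonneg h.le, exponentialPDF_of_nonneg (by positivity),
          ← ENNReal.ofReal_mul (Real.exp_nonneg _)]
        congr 1
        rw [mul_left_comm, ← Real.exp_add]
        ring_nf
    · simp [Set.indicator, hxD]
  have := isProbabilityMeasure_expMeasure hr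
  rw [key C hC]
  congr 1
  -- The whole line as target set identifies the exponential factor as the tail probability.
  have := key Set.univ .univ
  simp only [measure_univ, mul_one] at this
  rw [← this]
  simp [Set.Ioi]

theorem expMeasure_ae_pos {r : ℝ} : ∀ᵐ x ∂(expMeasure r), 0 < x := by
  rw [ae_iff, expMeasure_apply _ (by measurability)]
  have : ∫⁻ x : ℝ, {a : ℝ | ¬ 0 < a}.indicator (exponentialPDF r) x = ∫⁻ x : ℝ, 0 := by
    refine lintegral_congr_ae ?_
    have h0 : ∀ᵐ x : ℝ, x ≠ 0 := by simp [ae_iff]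
    filter_upwards [h0] with x hx
    rcases lt_or_gt_of_ne hx with h | h
    · simp [Set.indicator, exponentialPDF_of_neg h]
    · simp [Set.indicator, h]
  simpa using this

theorem integrable_pow_expMeasure {r : ℝ} (hr : 0 < r) (n : ℕ) :
    Integrable (fun x : ℝ => x ^ n) (expMeasure r) := by
  rw [expMeasure, gammaMeasure, integrable_withDensity_iff_integrable_smul₀'
    (f := gammaPDF 1 r) (measurable_exponentialPDF r).aemeasurable (by simp [gammaPDF])]
  have h : IntegrableOn (fun x : ℝ => x ^ (n : ℝ) * Real.exp (-r * x)) (Set.Ioi 0) := by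
    simpa using integrableOn_rpow_mul_exp_neg_mul_rpow (p := 1) (s := n)
      (by have : (0 : ℝ) ≤ n := n.cast_nonneg
          linarith) one_pos hr
  have h2 := ((integrable_indicator_iff measurableSet_Ioi).2 h).const_mul r
  refine h2.congr ?_
  have h0 : ∀ᵐ x : ℝ, x ≠ 0 := by simp [ae_iff]
  filter_upwards [h0] with x hx
  rcases lt_or_gt_of_ne hx with h | h
  · simp [Set.indicator, gammaPDF_of_neg h, h.le]
  · have := exponentialPDF_of_nonneg (r := r) h.le
    unfold exponentialPDF exponentialPDFReal at this
    rw [gammaPDF, this, ENNReal.toReal_ofReal (by positivity)]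
    simp [Set.indicator, h]
    ring

theorem expMean_pos {r : ℝ} (hr : 0 < r) : 0 < expMean r := by
  have := isProbabilityMeasure_expMeasure hr
  have hint : Integrable (fun x : ℝ => x) (expMeasure r) := by
    simpa using integrable_pow_expMeasure hr 1
  rw [expMean, integral_pos_iff_support_of_nonneg_ae
    (expMeasure_ae_pos.mono fun x hx => hx.le) hint]
  have hae : ∀ᵐ x ∂(expMeasure r), x ∈ Function.support fun x : ℝ => x :=
    expMeasure_ae_pos.mono fun x hx => hx.ne'
  rw [(mem_ae_iff_prob_eq_one (s := Function.support fun x : ℝ => x)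
    (measurableSet_support measurable_id)).1 hae]
  exact one_pos

/-- Areas are quadratic in the times and the law of large numbers below works in L², so fourth
moments are required. -/
theorem memLp_four_expMeasure {r : ℝ} (hr : 0 < r) :
    MemLp (fun x : ℝ => x) 4 (expMeasure r) := by
  have h := integrable_pow_expMeasure hr 4
  rw [← integrable_norm_rpow_iff (by fun_prop) (by norm_num) (by norm_num)]
  refine h.congr (.of_forall fun x => ?_)
  simp only [ENNReal.toReal_ofNat, Real.norm_eq_abs]
  norm_cast
  rw [pow_abs, abs_of_nonneg (by positivity)]

end GilbertElliot

namespace GilbertElliot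

/-! ### Independent exponential sequences and the memoryless property -/

/-- Prepend a term to a sequence. -/
def consSeq (x : ℝ) (b : ℕ → ℝ) : ℕ → ℝ
  | 0 => x
  | n + 1 => b n

@[simp]
theorem consSeq_zero (x : ℝ) (b : ℕ → ℝ) : consSeq x b 0 = x := rfl

@[simp]
theorem consSeq_succ (x : ℝ) (b : ℕ → ℝ) (n : ℕ) : consSeq x b (n + 1) = b n := rfl

@[simp]
theorem consSeq_one_add (x : ℝ) (b : ℕ → ℝ) (n : ℕ) : consSeq x b (1 + n) = b n := by
  rw [add_comm, consSeq_succ]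

/-- Law of a sequence of independent exponential variables of rate `lam`. -/
noncomputable abbrev expSeq (lam : ℝ) : Measure (ℕ → ℝ) := Measure.infinitePi fun _ => expMeasure lam

/-- The partial sums of `a` exceed the level `s` for the first time at the term of index `n`. -/
def crosses (s : ℝ) (n : ℕ) : Set (ℕ → ℝ) :=
  {a | ∑ i ∈ Finset.range n, a i ≤ s ∧ s < ∑ i ∈ Finset.range (n + 1), a i}

/-- The sequence seen from level `s` if this level is exceeded at the term of index `n`: overshoot,
followed by the remaining terms. -/
def restart (s : ℝ) (n : ℕ) (a : ℕ → ℝ) : ℕ → ℝ :=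
  consSeq (∑ i ∈ Finset.range (n + 1), a i - s) fun k => a (n + 1 + k)

theorem measurable_consSeq : Measurable fun z : ℝ × (ℕ → ℝ) => consSeq z.1 z.2 := by
  refine measurable_pi_iff.2 fun n => ?_
  cases n with
  | zero => exact measurable_fst
  | succ n => exact (measurable_pi_apply n).comp measurable_snd

theorem measurable_restart (s : ℝ) (n : ℕ) : Measurable (restart s n) := by
  have h : Measurable fun a : ℕ → ℝ =>
      ((∑ i ∈ Finset.range (n + 1), a i - s, fun k => a (n + 1 + k)) : ℝ × (ℕ → ℝ)) := by
    fun_prop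
  exact measurable_consSeq.comp h

theorem measurableSet_crosses (s : ℝ) (n : ℕ) : MeasurableSet (crosses s n) := by
  have h : ∀ m : ℕ, Measurable fun a : ℕ → ℝ => ∑ i ∈ Finset.range m, a i := fun m => by fun_prop
  exact (measurableSet_le (h n) measurable_const).inter
    (measurableSet_lt measurable_const (h (n + 1)))

/-- The head of an i.i.d. sequence is independent of its tail, and the tail has the law of the
whole. This permits conditioning on the first term. -/
theorem map_consSeq {lam : ℝ} (hlam : 0 < lam) :
    ((expMeasure lam).prod (expSeq lam)).map (fun z => consSeq z.1 z.2) = expSeq lam := by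
  have := isProbabilityMeasure_expMeasure hlam
  refine Measure.eq_infinitePi _ fun s t ht => ?_
  rw [Measure.map_apply measurable_consSeq (.pi s.countable_toSet fun i _ => ht i)]
  -- The cylinder is padded with `Set.univ` to one over an initial segment, so that the product over
  -- its coordinates can be reindexed by the shift.
  set t' : ℕ → Set ℝ := fun i => if i ∈ s then t i else Set.univ with ht'
  have hm' : ∀ i, MeasurableSet (t' i) := fun i => by
    by_cases h : i ∈ s <;> simp [ht', h, ht i]
  obtain ⟨N, hN⟩ : ∃ N, s ⊆ Finset.range (N + 1) :=
    ⟨s.sup id, fun i hi => Finset.mem_range.2 (Nat.lt_succ_of_le (Finset.le_sup (f := id) hi))⟩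
  have e1 : (fun z : ℝ × (ℕ → ℝ) => consSeq z.1 z.2) ⁻¹' (Set.pi s t) =
      t' 0 ×ˢ (Set.pi (Finset.range N) fun i => t' (i + 1)) := by
    ext ⟨x, b⟩
    simp only [Set.mem_preimage, Set.mem_pi, Set.mem_prod, ht', SetLike.mem_coe, Finset.mem_range]
    constructor
    · intro h
      refine ⟨?_, fun i _ => ?_⟩
      · by_cases h0 : 0 ∈ s
        · simpa [h0] using h 0 h0
        · simp [h0]
      · by_cases h0 : i + 1 ∈ s
        · simpa [h0] using h _ h0
        · simp [h0]
    · rintro ⟨h0, h1⟩ i hi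
      cases i with
      | zero => simpa [hi] using h0
      | succ i =>
        have := h1 i (by have := Finset.mem_range.1 (hN hi); omega)
        simpa [hi] using this
  rw [e1, Measure.prod_prod, expSeq, Measure.infinitePi_pi _ fun i _ => hm' (i + 1), mul_comm,
    ← Finset.prod_range_succ' (fun i => expMeasure lam (t' i)), ← Finset.prod_subset hN]
  · refine Finset.prod_congr rfl fun i hi => by simp [ht', hi]
  · intro i _ hi
    simp [ht', hi]

theorem expSeq_apply {lam : ℝ} (hlam : 0 < lam) {E : Set (ℕ → ℝ)} (hE : MeasurableSet E) :
    expSeq lam E = ∫⁻ x, expSeq lam {b | consSeq x b ∈ E} ∂(expMeasure lam) := by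
  have := isProbabilityMeasure_expMeasure hlam
  conv_lhs => rw [← map_consSeq hlam]
  rw [Measure.map_apply measurable_consSeq hE, Measure.prod_apply (measurable_consSeq hE)]
  rfl

theorem expSeq_tail {lam : ℝ} (hlam : 0 < lam) {C : Set (ℕ → ℝ)} (hC : MeasurableSet C) :
    expSeq lam {a | (fun k => a (1 + k)) ∈ C} = expSeq lam C := by
  have := isProbabilityMeasure_expMeasure hlam
  have hm : MeasurableSet {a : ℕ → ℝ | (fun k => a (1 + k)) ∈ C} :=
    hC.preimage (by fun_prop : Measurable fun (a : ℕ → ℝ) k => a (1 + k))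
  rw [expSeq_apply hlam hm]
  simp only [Set.mem_ofPred_eq, consSeq_one_add]
  change ∫⁻ _, expSeq lam C ∂_ = _
  simp

theorem expSeq_head_tail {lam : ℝ} (hlam : 0 < lam) {B : Set ℝ} (hB : MeasurableSet B)
    {C : Set (ℕ → ℝ)} (hC : MeasurableSet C) :
    expSeq lam {a | a 0 ∈ B ∧ (fun k => a (1 + k)) ∈ C} = expMeasure lam B * expSeq lam C := by
  have hm : MeasurableSet {a : ℕ → ℝ | a 0 ∈ B ∧ (fun k => a (1 + k)) ∈ C} :=
    (hB.preimage (measurable_pi_apply 0)).inter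
      (hC.preimage (by fun_prop : Measurable fun (a : ℕ → ℝ) k => a (1 + k)))
  rw [expSeq_apply hlam hm]
  have e : ∀ x, expSeq lam {b | consSeq x b ∈ {a : ℕ → ℝ | a 0 ∈ B ∧ (fun k => a (1 + k)) ∈ C}} =
      B.indicator (fun _ => expSeq lam C) x := fun x => by
    by_cases hx : x ∈ B
    · simp only [Set.mem_ofPred_eq, consSeq_zero, hx, consSeq_one_add, true_and,
        Set.indicator_of_mem]
      rfl
    · simp [hx]
  simp_rw [e]
  rw [lintegral_indicator_const hB, mul_comm]

/-- Conditioning on the first term x replaces the level s by s - x and the crossing index n + 1 by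
n. After these reductions the crossing happens at the first term, where memorylessness applies. -/
theorem expSeq_crosses_restart {lam : ℝ} (hlam : 0 < lam) {C : Set (ℕ → ℝ)}
    (hC : MeasurableSet C) (n : ℕ) (s : ℝ) :
    expSeq lam {a | a ∈ crosses s n ∧ restart s n a ∈ C} =
      expSeq lam (crosses s n) * expSeq lam C := by
  have := isProbabilityMeasure_expMeasure hlam
  have hm : ∀ n s, MeasurableSet {a | a ∈ crosses s n ∧ restart s n a ∈ C} := fun n s =>
    (measurableSet_crosses s n).inter (hC.preimage (measurable_restart s n))
  have hr : ∀ s x b, restart s 0 (consSeq x b) = consSeq (x - s) b := fun s x b => by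
    unfold restart
    congr 1
    · simp
    · funext k
      rw [add_comm]
      rfl
  induction n generalizing s with
  | zero =>
    rw [expSeq_apply hlam (hm 0 s), expSeq_apply hlam (measurableSet_crosses s 0)]
    -- The induction can make the level negative; then the empty sum already exceeds it and both
    -- sides vanish.
    rcases lt_or_ge s 0 with hs | hs
    · have : ∀ a, a ∉ crosses s 0 := fun a h => by
        have := h.1
        simp at this
        linarith
      simp [this]
    · have e1 : ∀ x b, consSeq x b ∈ crosses s 0 ↔ s < x := fun x b => by
        simp [crosses, hs]
      simp only [e1]
      have hD : MeasurableSet {z : ℝ × (ℕ → ℝ) | consSeq z.1 z.2 ∈ C} := measurable_consSeq hC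
      set g : ℝ → ENNReal := fun y => expSeq lam {b | consSeq y b ∈ C} with hg
      have hgm : Measurable g := measurable_measure_prodMk_left hD
      have e2 : ∀ x, expSeq lam {b | s < x ∧ consSeq (x - s) b ∈ C} =
          (Set.Ioi s).indicator (fun x => g (x - s)) x := fun x => by
        by_cases hx : s < x <;> simp [hx, hg]
      have e3 : ∀ x, expSeq lam {b : ℕ → ℝ | s < x} =
          (Set.Ioi s).indicator (fun x => 1) x := fun x => by
        by_cases hx : s < x <;> simp [hx]
      simp_rw [Set.mem_ofPred_eq]
      simp_rw [e1, hr, e2, e3]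
      rw [lintegral_indicator measurableSet_Ioi, lintegral_indicator measurableSet_Ioi,
        setLIntegral_one, expSeq_apply hlam hC]
      -- Memorylessness as an identity of measures: the overshoot, on the event that it occurs, is a
      -- multiple of the original law.
      have hmap : ((expMeasure lam).restrict (Set.Ioi s)).map (fun x => x - s) =
          (expMeasure lam (Set.Ioi s)) • expMeasure lam := by
        ext D hD'
        rw [Measure.map_apply (by fun_prop) hD', Measure.restrict_apply (hD'.preimage (by fun_prop)),
          Measure.smul_apply, smul_eq_mul, ← expMeasure_memoryless hlam hs hD']
        congr 1
        ext x
        simp [and_comm]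
      rw [← lintegral_map (f := g) (g := fun x => x - s) hgm (by fun_prop), hmap,
        lintegral_smul_measure, smul_eq_mul]
  | succ n ih =>
    rw [expSeq_apply hlam (hm _ s), expSeq_apply hlam (measurableSet_crosses s _)]
    have e1 : ∀ x b, consSeq x b ∈ crosses s (n + 1) ↔ b ∈ crosses (s - x) n := fun x b => by
      simp only [crosses, Set.mem_ofPred_eq, Finset.sum_range_succ' (consSeq x b), consSeq_succ,
        consSeq_zero]
      constructor <;> rintro ⟨h1, h2⟩ <;> constructor <;> linarith
    have e2 : ∀ x b, restart s (n + 1) (consSeq x b) = restart (s - x) n b := fun x b => by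
      unfold restart
      congr 1
      · rw [Finset.sum_range_succ' (consSeq x b)]
        simp only [consSeq_succ, consSeq_zero]
        ring
      · funext k
        rw [show n + 1 + 1 + k = (n + 1 + k) + 1 by ring]
        rfl
    simp_rw [Set.mem_ofPred_eq]
    simp_rw [e1, e2, ih]
    rw [lintegral_mul_const' _ _ (measure_ne_top _ _)]
    rfl

theorem expSeq_ae_pos {lam : ℝ} (hlam : 0 < lam) : ∀ᵐ a ∂(expSeq lam), ∀ n, 0 < a n := by
  have := isProbabilityMeasure_expMeasure hlam
  refine ae_all_iff.2 fun n => ?_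
  exact (measurePreserving_eval_infinitePi (fun _ => expMeasure lam) n).quasiMeasurePreserving.ae
    expMeasure_ae_pos

theorem integrable_id_expMeasure {r : ℝ} (hr : 0 < r) :
    Integrable (fun x : ℝ => x) (expMeasure r) := by
  simpa using integrable_pow_expMeasure hr 1

/-- By the strong law the partial sums grow like n times a positive mean. -/
theorem expSeq_ae_unbounded {lam : ℝ} (hlam : 0 < lam) :
    ∀ᵐ a ∂(expSeq lam), Tendsto (fun n => ∑ i ∈ Finset.range n, a i) atTop atTop := by
  have := isProbabilityMeasure_expMeasure hlam
  have hmp := measurePreserving_eval_infinitePi fun _ : ℕ => expMeasure lam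
  have hind : iIndepFun (fun (i : ℕ) (a : ℕ → ℝ) => a i) (expSeq lam) :=
    iIndepFun_infinitePi (X := fun _ x => x) fun _ => measurable_id
  have hint : Integrable (fun a : ℕ → ℝ => a 0) (expSeq lam) :=
    (hmp 0).integrable_comp_of_integrable (integrable_id_expMeasure hlam)
  have hmean : ∫ a, a 0 ∂(expSeq lam) = expMean lam := by
    rw [expMean, ← (hmp 0).map_eq, integral_map (hmp 0).measurable.aemeasurable (by fun_prop)]
  have hid : ∀ i, IdentDistrib (fun a : ℕ → ℝ => a i) (fun a => a 0) (expSeq lam) (expSeq lam) :=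
    fun i => ⟨(measurable_pi_apply i).aemeasurable, (measurable_pi_apply 0).aemeasurable, (hmp i).map_eq.trans (hmp 0).map_eq.symm⟩
  filter_upwards [strong_law_ae_real _ hint (fun i j hij => hind.indepFun hij) hid] with a ha
  rw [hmean] at ha
  have := ha.pos_mul_atTop (expMean_pos hlam) tendsto_natCast_atTop_atTop
  refine this.congr' ?_
  filter_upwards [eventually_gt_atTop 0] with n hn
  field_simp

end GilbertElliot

namespace GilbertElliot

/-! ### Idle periods -/

/-- Time that the server is idle after the `j`-th service. -/
noncomputable def idleTime (A S : ℕ → ℝ) (j : ℕ) : ℝ := entryTime A S (j + 1) - deliveryTime A S j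

/-- Interarrival times for which the arrivals are isolated and do not accumulate. -/
structure RegularArrivals (A : ℕ → ℝ) : Prop where
  pos : ∀ n, 0 < A n
  unbounded : Tendsto (fun n => ∑ i ∈ Finset.range n, A i) atTop atTop

theorem expSeq_ae_regular {lam : ℝ} (hlam : 0 < lam) : ∀ᵐ a ∂(expSeq lam), RegularArrivals a := by
  filter_upwards [expSeq_ae_pos hlam, expSeq_ae_unbounded hlam] with a h1 h2 using ⟨h1, h2⟩

theorem exists_crosses {a : ℕ → ℝ} (ha : Tendsto (fun n => ∑ i ∈ Finset.range n, a i) atTop atTop)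
    {s : ℝ} (hs : 0 ≤ s) : ∃ n, a ∈ crosses s n := by
  classical
  have hex : ∃ n, s < ∑ i ∈ Finset.range (n + 1), a i :=
    ((ha.comp (tendsto_add_atTop_nat 1)).eventually_gt_atTop s).exists
  refine ⟨Nat.find hex, ?_, Nat.find_spec hex⟩
  rcases h : Nat.find hex with _ | m
  · simpa using hs
  · exact not_lt.1 (Nat.find_min hex (m := m) (by omega))

theorem crosses_unique {a : ℕ → ℝ} (ha : ∀ n, 0 < a n) {s : ℝ} {m n : ℕ} (hm : a ∈ crosses s m)
    (hn : a ∈ crosses s n) : m = n := by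
  have mono : StrictMono fun n => ∑ i ∈ Finset.range n, a i :=
    strictMono_nat_of_lt_succ fun n => by
      rw [Finset.sum_range_succ]
      linarith [ha n]
  have h1 := mono.lt_iff_lt.1 (hm.1.trans_lt hn.2)
  have h2 := mono.lt_iff_lt.1 (hn.1.trans_lt hm.2)
  omega

/-- The overshoot over a fixed level, followed by the later terms, has the law of the sequence
itself. -/
theorem expSeq_restart {lam : ℝ} (hlam : 0 < lam) {C : Set (ℕ → ℝ)} (hC : MeasurableSet C)
    {s : ℝ} (hs : 0 ≤ s) :
    expSeq lam {a | ∃ n, a ∈ crosses s n ∧ restart s n a ∈ C} = expSeq lam C := by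
  have := isProbabilityMeasure_expMeasure hlam
  have key : ∀ D : Set (ℕ → ℝ), MeasurableSet D →
      expSeq lam {a | ∃ n, a ∈ crosses s n ∧ restart s n a ∈ D} =
        (∑' n, expSeq lam (crosses s n)) * expSeq lam D := by
    intro D hD
    rw [← ENNReal.tsum_mul_right]
    simp_rw [← expSeq_crosses_restart hlam hD]
    rw [Set.ofPred_exists, measure_iUnion₀]
    · intro i j hij
      refine measure_mono_null ?_ (expSeq_ae_pos hlam)
      rintro a ⟨h1, h2⟩ ha
      exact hij (crosses_unique ha h1.1 h2.1)
    · exact fun n => ((measurableSet_crosses s n).inter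
        (hD.preimage (measurable_restart s n))).nullMeasurableSet
  -- The total crossing probability is read off from the case where nothing is required of the
  -- restarted sequence; it is 1 because the sums are unbounded.
  have h1 := key Set.univ .univ
  rw [measure_univ, mul_one] at h1
  rw [key C hC, ← h1]
  have h2 : expSeq lam {a | ∃ n, a ∈ crosses s n ∧ restart s n a ∈ Set.univ} = 1 := by
    rw [← measure_univ (μ := expSeq lam), measure_congr]
    refine eventuallyEq_univ.2 ?_
    filter_upwards [expSeq_ae_unbounded hlam] with a ha
    simpa using exists_crosses ha hs
  rw [h2, one_mul]

theorem arrivalTime_add (A : ℕ → ℝ) (N k : ℕ) :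
    arrivalTime A (N + 1 + k) =
      arrivalTime A N + ∑ i ∈ Finset.range (k + 1), A (N + 1 + i) := by
  rw [arrivalTime, arrivalTime, ← Finset.sum_range_add]
  rfl

theorem arrivalTime_strictMono {A : ℕ → ℝ} (hA : ∀ n, 0 < A n) : StrictMono (arrivalTime A) :=
  strictMono_nat_of_lt_succ fun n => by
    rw [arrivalTime, arrivalTime, Finset.sum_range_succ _ (n + 1)]
    linarith [hA (n + 1)]

/-- Turns the blocking rule into a first passage: the interarrival times after the entering packet
cross the level `S j`. The overshoot of this crossing is the idle period. -/
theorem entryIndex_succ {A S : ℕ → ℝ} (hA : RegularArrivals A) (j : ℕ) (hS : 0 ≤ S j) :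
    ∃ k, entryIndex A S (j + 1) = entryIndex A S j + 1 + k ∧
      (fun i => A (entryIndex A S j + 1 + i)) ∈ crosses (S j) k := by
  set N := entryIndex A S j with hN
  -- Unboundedness excludes the default value 0 of `sInf` on the empty set.
  have hne : {n | arrivalTime A N + S j < arrivalTime A n}.Nonempty :=
    ((hA.unbounded.comp (tendsto_add_atTop_nat 1)).eventually_gt_atTop _).exists
  have hmem := Nat.sInf_mem hne
  have hdef : entryIndex A S (j + 1) = sInf {n | arrivalTime A N + S j < arrivalTime A n} := rfl
  rw [← hdef] at hmem
  have hlt : N < entryIndex A S (j + 1) := by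
    refine (arrivalTime_strictMono hA.pos).lt_iff_lt.1 (lt_of_le_of_lt ?_ hmem)
    linarith
  obtain ⟨k, hk⟩ := Nat.exists_eq_add_of_le (Nat.succ_le_of_lt hlt)
  refine ⟨k, hk, ?_, ?_⟩
  · rcases k with _ | k
    · simpa using hS
    · have h : N + 1 + k ∉ {n | arrivalTime A N + S j < arrivalTime A n} :=
        Nat.notMem_of_lt_sInf (by rw [← hdef, hk]; omega)
      rw [Set.mem_ofPred_eq, arrivalTime_add] at h
      linarith
  · rw [Set.mem_ofPred_eq, hk, Nat.succ_eq_add_one, arrivalTime_add] at hmem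
    linarith

theorem idleTime_pos {A S : ℕ → ℝ} (hA : RegularArrivals A) (j : ℕ) (hS : 0 ≤ S j) :
    0 < idleTime A S j := by
  obtain ⟨k, hk, h1, h2⟩ := entryIndex_succ hA j hS
  rw [idleTime, deliveryTime, entryTime, entryTime, hk, arrivalTime_add]
  linarith

/-- For fixed service times, the idle periods are independent and exponential. -/
theorem expSeq_idleTime {lam : ℝ} (hlam : 0 < lam) {S : ℕ → ℝ} (hS : ∀ j, 0 ≤ S j)
    {B : ℕ → Set ℝ} (hB : ∀ i, MeasurableSet (B i)) (j : ℕ) {C : Set (ℕ → ℝ)}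
    (hC : MeasurableSet C) :
    expSeq lam {a | (∀ i < j, idleTime a S i ∈ B i) ∧
        (fun k => a (entryIndex a S j + 1 + k)) ∈ C} =
      (∏ i ∈ Finset.range j, expMeasure lam (B i)) * expSeq lam C := by
  -- The event `C` about the interarrival times after the `j`-th entry must vary: the next idle
  -- period and the arrivals after it are encoded as such an event.
  induction j generalizing C with
  | zero => simpa [entryIndex] using expSeq_tail hlam hC
  | succ j ih =>
    have hD : MeasurableSet {a : ℕ → ℝ | a 0 ∈ B j ∧ (fun k => a (1 + k)) ∈ C} :=
      ((hB j).preimage (measurable_pi_apply 0)).inter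
        (hC.preimage (by fun_prop : Measurable fun (a : ℕ → ℝ) k => a (1 + k)))
    have hD' : MeasurableSet {a | ∃ n, a ∈ crosses (S j) n ∧ restart (S j) n a ∈
        {a : ℕ → ℝ | a 0 ∈ B j ∧ (fun k => a (1 + k)) ∈ C}} := by
      rw [Set.ofPred_exists]
      exact .iUnion fun n => (measurableSet_crosses _ n).inter
        (hD.preimage (measurable_restart _ n))
    -- Read from right to left, the product becomes the probability of one event about the restarted
    -- sequence. It remains to see that this event agrees with the left one on regular arrivals.
    rw [Finset.prod_range_succ, mul_assoc, ← expSeq_head_tail hlam (hB j) hC,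
      ← expSeq_restart hlam hD (hS j), ← ih hD']
    refine measure_congr ?_
    filter_upwards [expSeq_ae_regular hlam] with a ha
    obtain ⟨k, hk, hc⟩ := entryIndex_succ ha j (hS j)
    have hidle : idleTime a S j =
        ∑ i ∈ Finset.range (k + 1), a (entryIndex a S j + 1 + i) - S j := by
      rw [idleTime, deliveryTime, entryTime, entryTime, hk, arrivalTime_add]
      ring
    refine propext ?_
    change ((∀ i < j + 1, _) ∧ _) ↔ ((∀ i < j, _) ∧ ∃ n, _ ∧ _)
    have hu : (∃ n, (fun i => a (entryIndex a S j + 1 + i)) ∈ crosses (S j) n ∧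
        restart (S j) n (fun i => a (entryIndex a S j + 1 + i)) 0 ∈ B j ∧
        (fun i => restart (S j) n (fun i => a (entryIndex a S j + 1 + i)) (1 + i)) ∈ C) ↔
        restart (S j) k (fun i => a (entryIndex a S j + 1 + i)) 0 ∈ B j ∧
        (fun i => restart (S j) k (fun i => a (entryIndex a S j + 1 + i)) (1 + i)) ∈ C := by
      constructor
      · rintro ⟨n, h1, h2⟩
        rwa [crosses_unique (fun i => ha.pos _) hc h1]
      · exact fun h => ⟨k, hc, h⟩
    rw [hu, Nat.forall_lt_succ_right, and_assoc]
    refine and_congr_right fun _ => ?_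
    simp only [restart, consSeq_zero, consSeq_one_add, hidle, hk]
    simp only [add_assoc]

theorem measurable_arrivalTime (n : ℕ) :
    Measurable fun z : (ℕ → ℝ) × (ℕ → ℝ) => arrivalTime z.1 n := by
  unfold arrivalTime
  fun_prop

theorem measurable_entryIndex (j : ℕ) :
    Measurable fun z : (ℕ → ℝ) × (ℕ → ℝ) => entryIndex z.1 z.2 j := by
  have hT := measurable_arrivalTime
  induction j with
  | zero => exact measurable_const
  | succ j ih =>
    have hU : Measurable fun z : (ℕ → ℝ) × (ℕ → ℝ) => arrivalTime z.1 (entryIndex z.1 z.2 j) :=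
      measurable_from_prod_countable_left (f := fun p : ((ℕ → ℝ) × (ℕ → ℝ)) × ℕ =>
        arrivalTime p.1.1 p.2) hT |>.comp (measurable_id.prodMk ih)
    have hset : ∀ n, MeasurableSet {z : (ℕ → ℝ) × (ℕ → ℝ) |
        arrivalTime z.1 (entryIndex z.1 z.2 j) + z.2 j < arrivalTime z.1 n} := fun n =>
      measurableSet_lt (hU.add ((measurable_pi_apply j).comp measurable_snd)) (hT n)
    classical
    refine measurable_to_countable' fun n => ?_
    -- Either `n` is the least element of the set, or the set is empty and `sInf` takes its default
    -- value 0.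
    have e : (fun z : (ℕ → ℝ) × (ℕ → ℝ) => entryIndex z.1 z.2 (j + 1)) ⁻¹' {n} =
        ({z | arrivalTime z.1 (entryIndex z.1 z.2 j) + z.2 j < arrivalTime z.1 n} ∩
          ⋂ m ∈ Finset.range n,
            {z | arrivalTime z.1 (entryIndex z.1 z.2 j) + z.2 j < arrivalTime z.1 m}ᶜ) ∪
        ({z | n = 0} ∩
          ⋂ m, {z | arrivalTime z.1 (entryIndex z.1 z.2 j) + z.2 j < arrivalTime z.1 m}ᶜ) := by
      ext z
      simp only [Set.mem_preimage, Set.mem_singleton_iff, Set.mem_union, Set.mem_inter_iff,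
        Set.mem_iInter, Set.mem_compl_iff, Set.mem_ofPred_eq, Finset.mem_range]
      change sInf {n | arrivalTime z.1 (entryIndex z.1 z.2 j) + z.2 j < arrivalTime z.1 n} = n ↔ _
      constructor
      · rintro rfl
        rcases Set.eq_empty_or_nonempty
          {n | arrivalTime z.1 (entryIndex z.1 z.2 j) + z.2 j < arrivalTime z.1 n} with h | h
        · right
          rw [h]
          exact ⟨Nat.sInf_empty, fun m hm => (h ▸ hm : m ∈ (∅ : Set ℕ))⟩
        · exact Or.inl ⟨Nat.sInf_mem h, fun m hm => Nat.notMem_of_lt_sInf hm⟩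
      · rintro (⟨h1, h2⟩ | ⟨rfl, h2⟩)
        · refine le_antisymm (Nat.sInf_le h1) (le_csInf ⟨n, h1⟩ fun m hm => ?_)
          by_contra! hlt
          exact h2 m hlt hm
        · rw [Nat.sInf_eq_zero]
          exact Or.inr (Set.eq_empty_of_forall_notMem h2)
    rw [e]
    exact ((hset n).inter (.biInter (Finset.range n).countable_toSet fun m _ => (hset m).compl)).union
      (.inter (.const _) (.iInter fun m => (hset m).compl))

theorem measurable_entryTime (j : ℕ) :
    Measurable fun z : (ℕ → ℝ) × (ℕ → ℝ) => entryTime z.1 z.2 j :=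
  measurable_from_prod_countable_left (f := fun p : ((ℕ → ℝ) × (ℕ → ℝ)) × ℕ =>
    arrivalTime p.1.1 p.2) measurable_arrivalTime |>.comp
      (measurable_id.prodMk (measurable_entryIndex j))

theorem measurable_idleTime (j : ℕ) :
    Measurable fun z : (ℕ → ℝ) × (ℕ → ℝ) => idleTime z.1 z.2 j :=
  (measurable_entryTime (j + 1)).sub
    ((measurable_entryTime j).add ((measurable_pi_apply j).comp measurable_snd))

end GilbertElliot

namespace GilbertElliot

/-! ### Law of the service process and of the idle periods -/

open Classical in
noncomputable instance : Fintype ServerState :=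
  ⟨{.bad, .good}, fun s => by cases s <;> simp⟩

theorem sum_serverState {M : Type*} [AddCommMonoid M] (f : ServerState → M) :
    ∑ s, f s = f .bad + f .good := by
  classical
  change ∑ s ∈ ({.bad, .good} : Finset ServerState), f s = _
  rw [Finset.sum_pair (by simp)]

instance : DiscreteMeasurableSpace ServerState := ⟨fun _ => trivial⟩

/-- Joint law of a service time in state `s` and of the idle period that follows it. -/
noncomputable abbrev cycleLaw (lam μb μg : ℝ) (s : ServerState) : Measure (ℝ × ℝ) :=
  (expMeasure (serviceRate μb μg s)).prod (expMeasure lam)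

theorem serviceRate_pos {μb μg : ℝ} (hμb : 0 < μb) (hμg : 0 < μg) (s : ServerState) :
    0 < serviceRate μb μg s := by
  cases s <;> assumption

theorem isProbabilityMeasure_cycleLaw {lam μb μg : ℝ} (hlam : 0 < lam) (hμb : 0 < μb)
    (hμg : 0 < μg) (s : ServerState) : IsProbabilityMeasure (cycleLaw lam μb μg s) := by
  have := isProbabilityMeasure_expMeasure hlam
  have := isProbabilityMeasure_expMeasure (serviceRate_pos hμb hμg s)
  infer_instance

/-- Extension of a finite path of server states to an infinite one. -/
def extendPath {n : ℕ} (σ : Fin (n + 1) → ServerState) (i : ℕ) : ServerState :=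
  if h : i < n + 1 then σ ⟨i, h⟩ else .bad

theorem extendPath_apply (x : ℕ → ServerState) {n i : ℕ} (hi : i ≤ n) :
    extendPath (fun k : Fin (n + 1) => x k) i = x i := by
  simp [extendPath, Nat.lt_succ_of_le hi]

/-- Service time and subsequent idle period of cycle `j`. -/
noncomputable def cycleTimes {Ω : Type*} (A S : ℕ → Ω → ℝ) (j : ℕ) (ω : Ω) : ℝ × ℝ :=
  (S j ω, idleTime (A · ω) (S · ω) j)

/-- Event that the states, the service times and the idle periods up to index `n` are as
prescribed. -/
def historyEvent {Ω : Type*} (A : ℕ → Ω → ℝ) (X : ℕ → Ω → ServerState) (S : ℕ → Ω → ℝ) (n : ℕ)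
    (s : ℕ → ServerState) (B C : ℕ → Set ℝ) : Set Ω :=
  {ω | ∀ i ≤ n, X i ω = s i ∧ S i ω ∈ B i ∧ idleTime (A · ω) (S · ω) i ∈ C i}

/-- The σ-algebra of the history of the server up to index `n`. -/
@[reducible]
def history {Ω : Type*} (A : ℕ → Ω → ℝ) (X : ℕ → Ω → ServerState) (S : ℕ → Ω → ℝ) (n : ℕ) :
    MeasurableSpace Ω :=
  MeasurableSpace.generateFrom {H | ∃ s B C, (∀ i, MeasurableSet (B i)) ∧
    (∀ i, MeasurableSet (C i)) ∧ H = historyEvent A X S n s B C}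

variable {Ω : Type*} [MeasurableSpace Ω] {P : Measure Ω}
  {lam μb μg p q : ℝ} {A : ℕ → Ω → ℝ} {X : ℕ → Ω → ServerState} {S : ℕ → Ω → ℝ}

theorem measurable_state_of_discrete {α β : Type*} [MeasurableSpace α] [MeasurableSpace β]
    {f : ServerState → α → β} (hf : ∀ s, Measurable (f s)) {X : α → ServerState}
    (hX : Measurable X) : Measurable fun a => f (X a) a :=
  (measurable_from_prod_countable_left (f := fun z : α × ServerState => f z.2 z.1) hf).comp
    (measurable_id.prodMk hX)

namespace IsModel

variable (hM : IsModel P lam μb μg p q A X S)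

include hM

/-- The model prescribes service laws only jointly with a path of states, so the null event is
covered by the finitely many paths up to `n`. -/
theorem ae_service_pos : ∀ᵐ ω ∂P, ∀ j, 0 < S j ω := by
  refine ae_all_iff.2 fun n => ?_
  have hnull : ∀ σ : Fin (n + 1) → ServerState,
      P {ω | ∀ i ≤ n, X i ω = extendPath σ i ∧ S i ω ∈ if i = n then Set.Iic (0 : ℝ) else Set.univ}
        = 0 := by
    intro σ
    rw [hM.service n (extendPath σ) _ fun i => by split_ifs <;> measurability]
    refine mul_eq_zero_of_right _ (Finset.prod_eq_zero (Finset.self_mem_range_succ n) ?_)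
    rw [if_pos rfl]
    have := (ae_iff.1 (expMeasure_ae_pos (r := serviceRate μb μg (extendPath σ n))))
    simpa [Set.Iic] using this
  refine measure_mono_null ?_ (measure_iUnion_null hnull)
  intro ω hω
  have hω' : S n ω ≤ 0 := not_lt.1 hω
  refine Set.mem_iUnion.2 ⟨fun k => X k ω, fun i hi => ⟨(extendPath_apply (X · ω) hi).symm, ?_⟩⟩
  by_cases h : i = n
  · subst h; simpa using hω'
  · simp [h]

theorem map_arrivals [IsProbabilityMeasure P] : P.map (fun ω n => A n ω) = expSeq lam := by
  rw [hM.arrivals_indep.map_fun_eq_infinitePi_map hM.measurable_A]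
  simp_rw [hM.arrivals_law]

theorem measurable_arrivals : Measurable fun ω n => A n ω := measurable_pi_iff.2 hM.measurable_A

theorem measurable_services : Measurable fun ω n => S n ω := measurable_pi_iff.2 hM.measurable_S

theorem ae_regular [IsProbabilityMeasure P] (hlam : 0 < lam) :
    ∀ᵐ ω ∂P, RegularArrivals (A · ω) := by
  have h := expSeq_ae_regular hlam
  rw [← hM.map_arrivals] at h
  exact ae_of_ae_map hM.measurable_arrivals.aemeasurable h

theorem measurable_idleTime (j : ℕ) : Measurable fun ω => idleTime (A · ω) (S · ω) j :=
  Measurable.comp (g := fun z : (ℕ → ℝ) × (ℕ → ℝ) => idleTime z.1 z.2 j)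
    (f := fun ω => (fun n => A n ω, fun n => S n ω)) (GilbertElliot.measurable_idleTime j)
    (hM.measurable_arrivals.prodMk hM.measurable_services)

theorem measurable_cycleTimes (j : ℕ) : Measurable (cycleTimes A S j) :=
  (hM.measurable_S j).prodMk (hM.measurable_idleTime j)

/-- The idle periods are independent exponential variables, independent of the service process. -/
theorem measure_idleTime [IsProbabilityMeasure P] (hlam : 0 < lam) {C : ℕ → Set ℝ}
    (hC : ∀ i, MeasurableSet (C i)) (n : ℕ) {G : Set (ℕ → ServerState × ℝ)}
    (hG : MeasurableSet G) :
    P {ω | (∀ i < n, idleTime (A · ω) (S · ω) i ∈ C i) ∧ (fun j => (X j ω, S j ω)) ∈ G} =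
      (∏ i ∈ Finset.range n, expMeasure lam (C i)) * P {ω | (fun j => (X j ω, S j ω)) ∈ G} := by
  have := isProbabilityMeasure_expMeasure hlam
  have hmXS : Measurable fun ω j => (X j ω, S j ω) :=
    measurable_pi_iff.2 fun j => (hM.measurable_X j).prodMk (hM.measurable_S j)
  have hlaw := (indepFun_iff_map_prod_eq_prod_map_map hM.measurable_arrivals.aemeasurable
    hmXS.aemeasurable).1 hM.arrivals_indep_service
  rw [hM.map_arrivals] at hlaw
  set κ := P.map fun ω j => (X j ω, S j ω) with hκ
  have : IsProbabilityMeasure κ := Measure.isProbabilityMeasure_map hmXS.aemeasurable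
  have hsnd : Measurable fun z : ℕ → ServerState × ℝ => fun j => (z j).2 := by fun_prop
  have hE : MeasurableSet {z : (ℕ → ℝ) × (ℕ → ServerState × ℝ) |
      (∀ i < n, idleTime z.1 (fun j => (z.2 j).2) i ∈ C i) ∧ z.2 ∈ G} := by
    have h1 : ∀ i, MeasurableSet {z : (ℕ → ℝ) × (ℕ → ServerState × ℝ) |
        idleTime z.1 (fun j => (z.2 j).2) i ∈ C i} := fun i =>
      (hC i).preimage (Measurable.comp (g := fun z : (ℕ → ℝ) × (ℕ → ℝ) => idleTime z.1 z.2 i)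
        (f := fun z : (ℕ → ℝ) × (ℕ → ServerState × ℝ) => (z.1, fun j => (z.2 j).2))
        (GilbertElliot.measurable_idleTime i) (measurable_fst.prodMk (hsnd.comp measurable_snd)))
    have h2 : MeasurableSet {z : (ℕ → ℝ) × (ℕ → ServerState × ℝ) |
        ∀ i < n, idleTime z.1 (fun j => (z.2 j).2) i ∈ C i} := by
      simp only [Set.ofPred_forall]
      exact .iInter fun i => .iInter fun _ => h1 i
    exact h2.inter (hG.preimage measurable_snd)
  have hS : ∀ᵐ z ∂κ, ∀ j, 0 ≤ (z j).2 := by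
    rw [hκ, ae_map_iff hmXS.aemeasurable]
    · exact hM.ae_service_pos.mono fun ω h j => (h j).le
    · simp only [Set.ofPred_forall]
      exact .iInter fun j => measurableSet_le measurable_const
        (measurable_snd.comp (measurable_pi_apply j))
  have e1 : P {ω | (∀ i < n, idleTime (A · ω) (S · ω) i ∈ C i) ∧
      (fun j => (X j ω, S j ω)) ∈ G} = (P.map fun ω => ((fun n => A n ω), fun j => (X j ω, S j ω)))
        {z | (∀ i < n, idleTime z.1 (fun j => (z.2 j).2) i ∈ C i) ∧ z.2 ∈ G} := by
    rw [Measure.map_apply (hM.measurable_arrivals.prodMk hmXS) hE]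
    rfl
  have e2 : P {ω | (fun j => (X j ω, S j ω)) ∈ G} = κ G := by
    rw [hκ, Measure.map_apply hmXS hG]
    rfl
  -- Fubini with the service process outside: for almost every fixed service process the inner
  -- probability is given by `expSeq_idleTime`.
  rw [e1, e2, hlaw, Measure.prod_apply_symm hE, ← lintegral_indicator_const hG]
  refine lintegral_congr_ae ?_
  filter_upwards [hS] with z hz
  by_cases hzG : z ∈ G
  · have := expSeq_idleTime hlam hz hC n MeasurableSet.univ
    simp only [Set.mem_univ, and_true, measure_univ, mul_one] at this
    simpa [hzG, Set.preimage] using this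
  · simp [hzG, Set.preimage]

theorem measurableSet_historyEvent (n : ℕ) (s : ℕ → ServerState) {B C : ℕ → Set ℝ}
    (hB : ∀ i, MeasurableSet (B i)) (hC : ∀ i, MeasurableSet (C i)) :
    MeasurableSet (historyEvent A X S n s B C) := by
  unfold historyEvent
  simp only [Set.ofPred_forall]
  exact .iInter fun i => .iInter fun _ =>
    ((measurableSet_singleton (s i)).preimage (hM.measurable_X i)).inter
      (((hB i).preimage (hM.measurable_S i)).inter ((hC i).preimage (hM.measurable_idleTime i)))

theorem measure_historyEvent [IsProbabilityMeasure P] (hlam : 0 < lam) (n : ℕ)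
    (s : ℕ → ServerState) {B C : ℕ → Set ℝ} (hB : ∀ i, MeasurableSet (B i))
    (hC : ∀ i, MeasurableSet (C i)) :
    P (historyEvent A X S n s B C) = P {ω | ∀ i ≤ n, X i ω = s i} *
      ∏ i ∈ Finset.range (n + 1), cycleLaw lam μb μg (s i) (B i ×ˢ C i) := by
  have := isProbabilityMeasure_expMeasure hlam
  have hG : MeasurableSet {z : ℕ → ServerState × ℝ | ∀ i ≤ n, (z i).1 = s i ∧ (z i).2 ∈ B i} := by
    simp only [Set.ofPred_forall]
    exact .iInter fun i => .iInter fun _ =>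
      ((measurableSet_singleton (s i)).preimage (measurable_fst.comp (measurable_pi_apply i))).inter
        ((hB i).preimage (measurable_snd.comp (measurable_pi_apply i)))
  have h := hM.measure_idleTime hlam hC (n + 1) hG
  have e : historyEvent A X S n s B C = {ω | (∀ i < n + 1, idleTime (A · ω) (S · ω) i ∈ C i) ∧
      (fun j => (X j ω, S j ω)) ∈ {z : ℕ → ServerState × ℝ | ∀ i ≤ n, (z i).1 = s i ∧
        (z i).2 ∈ B i}} := by
    ext ω
    simp only [historyEvent, Set.mem_ofPred_eq, Nat.lt_succ_iff]
    exact ⟨fun h => ⟨fun i hi => (h i hi).2.2, fun i hi => ⟨(h i hi).1, (h i hi).2.1⟩⟩,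
      fun h i hi => ⟨(h.2 i hi).1, (h.2 i hi).2, h.1 i hi⟩⟩
  rw [e, h]
  simp only [Set.mem_ofPred_eq]
  rw [hM.service n s B hB]
  simp_rw [cycleLaw, Measure.prod_prod]
  rw [Finset.prod_mul_distrib]
  ring

/-- The Markov property on cylinders: the new factor depends on the past only through `s n`. -/
theorem measure_historyEvent_succ [IsProbabilityMeasure P] (hlam : 0 < lam) (n : ℕ)
    (s : ℕ → ServerState) {B C : ℕ → Set ℝ} (hB : ∀ i, MeasurableSet (B i))
    (hC : ∀ i, MeasurableSet (C i)) :
    P (historyEvent A X S (n + 1) s B C) = P (historyEvent A X S n s B C) *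
      (ENNReal.ofReal (transition p q (s n) (s (n + 1))) *
        cycleLaw lam μb μg (s (n + 1)) (B (n + 1) ×ˢ C (n + 1))) := by
  rw [hM.measure_historyEvent hlam _ _ hB hC, hM.measure_historyEvent hlam _ _ hB hC,
    Finset.prod_range_succ _ (n + 1), hM.chain]
  ring

end IsModel

end GilbertElliot

/-! ### The history σ-algebra and the Markov property -/

namespace GilbertElliot

section History

variable {Ω : Type*} {A : ℕ → Ω → ℝ} {X : ℕ → Ω → ServerState} {S : ℕ → Ω → ℝ}

theorem isPiSystem_historyEvent (n : ℕ) :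
    IsPiSystem {H | ∃ s B C, (∀ i, MeasurableSet (B i)) ∧
      (∀ i, MeasurableSet (C i)) ∧ H = historyEvent A X S n s B C} := by
  rintro _ ⟨s, B, C, hB, hC, rfl⟩ _ ⟨s', B', C', hB', hC', rfl⟩ ⟨ω₀, h1, h2⟩
  refine ⟨s, fun i => B i ∩ B' i, fun i => C i ∩ C' i, fun i => (hB i).inter (hB' i),
    fun i => (hC i).inter (hC' i), ?_⟩
  ext ω
  constructor
  · rintro ⟨h3, h4⟩ i hi
    exact ⟨(h3 i hi).1, ⟨(h3 i hi).2.1, (h4 i hi).2.1⟩, (h3 i hi).2.2, (h4 i hi).2.2⟩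
  · intro h
    refine ⟨fun i hi => ⟨(h i hi).1, (h i hi).2.1.1, (h i hi).2.2.1⟩,
      fun i hi => ⟨?_, (h i hi).2.1.2, (h i hi).2.2.2⟩⟩
    -- The common point `ω₀` forces the two prescribed state paths to agree up to `n`.
    rw [(h i hi).1, ← (h1 i hi).1, (h2 i hi).1]

/-- A generator prescribes all states up to `n`; a condition on one cycle is the finite union of
generators over the paths of the remaining states. -/
theorem measurableSet_history_box {n i : ℕ} (hi : i ≤ n) (s : ServerState) {B C : Set ℝ}
    (hB : MeasurableSet B) (hC : MeasurableSet C) :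
    MeasurableSet[history A X S n]
      {ω | X i ω = s ∧ S i ω ∈ B ∧ idleTime (A · ω) (S · ω) i ∈ C} := by
  classical
  have e : {ω | X i ω = s ∧ S i ω ∈ B ∧ idleTime (A · ω) (S · ω) i ∈ C} =
      ⋃ σ : Fin (n + 1) → ServerState, historyEvent A X S n
        (Function.update (extendPath σ) i s) (Function.update (fun _ => Set.univ) i B)
        (Function.update (fun _ => Set.univ) i C) := by
    ext ω
    simp only [Set.mem_ofPred_eq, Set.mem_iUnion]
    constructor
    · intro h
      refine ⟨fun k => X k ω, fun k hk => ?_⟩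
      by_cases hki : k = i
      · subst hki
        simpa using h
      · simp only [Function.update_of_ne hki, Set.mem_univ, and_self, and_true]
        exact (extendPath_apply (X · ω) hk).symm
    · rintro ⟨σ, h⟩
      simpa using h i hi
  rw [e]
  refine MeasurableSet.iUnion fun σ => MeasurableSpace.measurableSet_generateFrom
    ⟨_, _, _, fun k => ?_, fun k => ?_, rfl⟩
  · by_cases hki : k = i
    · subst hki; simpa using hB
    · simp [Function.update_of_ne hki]
  · by_cases hki : k = i
    · subst hki; simpa using hC
    · simp [Function.update_of_ne hki]

theorem measurable_history_state {n i : ℕ} (hi : i ≤ n) : Measurable[history A X S n] (X i) := by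
  let _ := history A X S n
  refine measurable_to_countable' fun s => ?_
  have h := measurableSet_history_box (A := A) (X := X) (S := S) hi s .univ .univ
  simp only [Set.mem_univ, and_true] at h
  exact h

theorem measurable_history_cycleTimes {n i : ℕ} (hi : i ≤ n) :
    Measurable[history A X S n] (cycleTimes A S i) := by
  let _ := history A X S n
  refine Measurable.prodMk (fun B hB => ?_) (fun C hC => ?_)
  · have : S i ⁻¹' B = ⋃ s, {ω | X i ω = s ∧ S i ω ∈ B ∧
        idleTime (A · ω) (S · ω) i ∈ Set.univ} := by
      ext ω; simp
    rw [this]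
    exact .iUnion fun s => measurableSet_history_box hi s hB .univ
  · have : (fun ω => idleTime (A · ω) (S · ω) i) ⁻¹' C = ⋃ s, {ω | X i ω = s ∧
        S i ω ∈ Set.univ ∧ idleTime (A · ω) (S · ω) i ∈ C} := by
      ext ω; simp
    rw [this]
    exact .iUnion fun s => measurableSet_history_box hi s .univ hC

end History

variable {Ω : Type*} [MeasurableSpace Ω] {P : Measure Ω}
  {lam μb μg p q : ℝ} {A : ℕ → Ω → ℝ} {X : ℕ → Ω → ServerState} {S : ℕ → Ω → ℝ}

namespace IsModel

variable (hM : IsModel P lam μb μg p q A X S)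

include hM

theorem history_le (n : ℕ) : history A X S n ≤ ‹MeasurableSpace Ω› := by
  refine MeasurableSpace.generateFrom_le ?_
  rintro _ ⟨s, B, C, hB, hC, rfl⟩
  exact hM.measurableSet_historyEvent n s hB hC

theorem measurableSet_state (n : ℕ) (s : ServerState) : MeasurableSet {ω | X n ω = s} :=
  (measurableSet_singleton s).preimage (hM.measurable_X n)

theorem measurableSet_states (n : ℕ) (s s' : ServerState) :
    MeasurableSet {ω | X n ω = s ∧ X (n + 1) ω = s'} :=
  (hM.measurableSet_state n s).inter (hM.measurableSet_state (n + 1) s')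

/-- The Markov property on boxes. -/
theorem measure_history_inter_box [IsProbabilityMeasure P] (hlam : 0 < lam) (n : ℕ)
    (s s' : ServerState) {B C : Set ℝ} (hB : MeasurableSet B) (hC : MeasurableSet C) {H : Set Ω}
    (hH : MeasurableSet[history A X S n] H) :
    P (H ∩ {ω | X n ω = s} ∩ {ω | X (n + 1) ω = s' ∧ S (n + 1) ω ∈ B ∧
        idleTime (A · ω) (S · ω) (n + 1) ∈ C}) =
      P (H ∩ {ω | X n ω = s}) *
        (ENNReal.ofReal (transition p q s s') * cycleLaw lam μb μg s' (B ×ˢ C)) := by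
  classical
  set c := ENNReal.ofReal (transition p q s s') * cycleLaw lam μb μg s' (B ×ˢ C) with hc
  set E := {ω | X (n + 1) ω = s' ∧ S (n + 1) ω ∈ B ∧ idleTime (A · ω) (S · ω) (n + 1) ∈ C} with hE
  have hEm : MeasurableSet E := (hM.measurableSet_state (n + 1) s').inter
    ((hB.preimage (hM.measurable_S _)).inter (hC.preimage (hM.measurable_idleTime _)))
  have hle := hM.history_le n
  have hXm : MeasurableSet {ω | X n ω = s} := hM.measurableSet_state n s
  -- As functions of `H`, both sides are finite measures on the history σ-algebra, so they are
  -- compared on the π-system of history events.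
  have key : (P.restrict ({ω | X n ω = s} ∩ E)).trim hle =
      c • (P.restrict {ω | X n ω = s}).trim hle := by
    -- The whole space need not be a generator, since each generator fixes the states; the finitely
    -- many state paths provide the cover that the uniqueness theorem needs.
    set T : Set (Set Ω) := Set.range fun σ : Fin (n + 1) → ServerState =>
      historyEvent A X S n (extendPath σ) (fun _ => Set.univ) (fun _ => Set.univ) with hT
    refine Measure.ext_of_generateFrom_of_cover_subset (T := T) (S := {H | ∃ s B C,
        (∀ i, MeasurableSet (B i)) ∧ (∀ i, MeasurableSet (C i)) ∧ H = historyEvent A X S n s B C})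
      rfl (isPiSystem_historyEvent n) ?_ (Set.countable_range _) ?_ ?_ ?_
    · rintro _ ⟨σ, rfl⟩
      exact ⟨_, _, _, fun _ => .univ, fun _ => .univ, rfl⟩
    · refine Set.eq_univ_of_forall fun ω => ⟨_, ⟨fun k => X k ω, rfl⟩, fun i hi => ?_⟩
      simpa using (extendPath_apply (X · ω) hi).symm
    · exact fun _ _ => measure_ne_top _ _
    · rintro H ⟨t, B', C', hB', hC', rfl⟩
      have hHm : MeasurableSet[history A X S n] (historyEvent A X S n t B' C') :=
        MeasurableSpace.measurableSet_generateFrom ⟨t, B', C', hB', hC', rfl⟩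
      rw [Measure.smul_apply, trim_measurableSet_eq _ hHm, trim_measurableSet_eq _ hHm,
        Measure.restrict_apply (hle _ hHm), Measure.restrict_apply (hle _ hHm), smul_eq_mul]
      by_cases hts : t n = s
      · have e1 : historyEvent A X S n t B' C' ∩ {ω | X n ω = s} = historyEvent A X S n t B' C' :=
          Set.inter_eq_left.2 fun ω h => (h n le_rfl).1.trans hts
        have hBu : ∀ i, MeasurableSet (Function.update B' (n + 1) B i) := fun i => by
          by_cases h : i = n + 1
          · subst h; simpa using hB
          · simpa [Function.update_of_ne h] using hB' i
        have hCu : ∀ i, MeasurableSet (Function.update C' (n + 1) C i) := fun i => by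
          by_cases h : i = n + 1
          · subst h; simpa using hC
          · simpa [Function.update_of_ne h] using hC' i
        -- The box is inserted as the condition at index n + 1, which leaves the event up to `n`
        -- unchanged.
        have hstep := hM.measure_historyEvent_succ hlam n (Function.update t (n + 1) s') hBu hCu
        have hn : n ≠ n + 1 := by omega
        rw [Function.update_self, Function.update_self, Function.update_self,
          Function.update_of_ne hn, hts, ← hc] at hstep
        have e2 : historyEvent A X S n (Function.update t (n + 1) s')
            (Function.update B' (n + 1) B) (Function.update C' (n + 1) C) =
            historyEvent A X S n t B' C' := by
          ext ω
          refine forall₂_congr fun i hi => ?_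
          have hi' : i ≠ n + 1 := by omega
          simp [Function.update_of_ne hi']
        have e3 : historyEvent A X S (n + 1) (Function.update t (n + 1) s')
            (Function.update B' (n + 1) B) (Function.update C' (n + 1) C) =
            historyEvent A X S n t B' C' ∩ E := by
          ext ω
          simp only [historyEvent, Set.mem_ofPred_eq, Nat.le_add_one_iff, or_imp, forall_and,
            forall_eq, Set.mem_inter_iff, Function.update_self, hE]
          have : ∀ i ≤ n, i ≠ n + 1 := fun i hi => by omega
          simp +contextual [Function.update_of_ne, this]
          tauto
        rw [← Set.inter_assoc, e1, ← e3, hstep, e2, mul_comm]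
      · have e1 : historyEvent A X S n t B' C' ∩ {ω | X n ω = s} = ∅ := by
          ext ω
          simp only [Set.mem_inter_iff, Set.mem_ofPred_eq, Set.mem_empty_iff_false, iff_false,
            not_and]
          exact fun h hs => hts ((h n le_rfl).1.symm.trans hs)
        rw [← Set.inter_assoc, e1]
        simp
  have := congrArg (fun m : Measure[history A X S n] Ω => m H) key
  rw [Measure.smul_apply, trim_measurableSet_eq _ hH, trim_measurableSet_eq _ hH,
    Measure.restrict_apply (hle _ hH), Measure.restrict_apply (hle _ hH), smul_eq_mul] at this
  rw [Set.inter_assoc, this, mul_comm]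

/-- The Markov property: given the present state, the next cycle is independent of the history. -/
theorem map_history_cycleTimes [IsProbabilityMeasure P] (hlam : 0 < lam) (hμb : 0 < μb)
    (hμg : 0 < μg) (n : ℕ) (s s' : ServerState) {𝓗 : Type*} [MeasurableSpace 𝓗] {h : Ω → 𝓗}
    (hh : Measurable[history A X S n] h) :
    (P.restrict {ω | X n ω = s ∧ X (n + 1) ω = s'}).map
        (fun ω => (h ω, cycleTimes A S (n + 1) ω)) =
      (ENNReal.ofReal (transition p q s s') • (P.restrict {ω | X n ω = s}).map h).prod
        (cycleLaw lam μb μg s') := by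
  have := isProbabilityMeasure_cycleLaw hlam hμb hμg s'
  have := isProbabilityMeasure_expMeasure hlam
  have := isProbabilityMeasure_expMeasure (serviceRate_pos hμb hμg s')
  have hle := hM.history_le n
  have hh' : Measurable h := hh.mono hle le_rfl
  have hW := hM.measurable_cycleTimes (n + 1)
  have hE := hM.measurableSet_states n s s'
  have : IsFiniteMeasure (ENNReal.ofReal (transition p q s s') •
      (P.restrict {ω | X n ω = s}).map h) := Measure.smul_finite _ ENNReal.ofReal_ne_top
  refine (Measure.prod_eq fun U V hU hV => ?_).symm
  have hHm : MeasurableSet[history A X S n] (h ⁻¹' U) := hh hU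
  -- With the history event fixed, boxes determine the law of the next cycle. The scalar is put on
  -- one factor so that uniqueness of product measures applies.
  have key : (P.restrict (h ⁻¹' U ∩ {ω | X n ω = s ∧ X (n + 1) ω = s'})).map
      (cycleTimes A S (n + 1)) = (((P (h ⁻¹' U ∩ {ω | X n ω = s}) *
        ENNReal.ofReal (transition p q s s')) • expMeasure (serviceRate μb μg s'))).prod
          (expMeasure lam) := by
    have : IsFiniteMeasure ((P (h ⁻¹' U ∩ {ω | X n ω = s}) *
        ENNReal.ofReal (transition p q s s')) • expMeasure (serviceRate μb μg s')) :=
      Measure.smul_finite _ (ENNReal.mul_ne_top (measure_ne_top _ _) ENNReal.ofReal_ne_top)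
    refine (Measure.prod_eq fun B C hB hC => ?_).symm
    rw [Measure.map_apply hW (hB.prod hC), Measure.restrict_apply (hW (hB.prod hC)),
      Measure.smul_apply, smul_eq_mul]
    have := hM.measure_history_inter_box hlam n s s' hB hC hHm
    rw [cycleLaw, Measure.prod_prod] at this
    rw [mul_assoc, mul_assoc, ← this]
    congr 1
    ext ω
    simp only [cycleTimes, Set.mem_inter_iff, Set.mem_preimage, Set.mem_prod, Set.mem_ofPred_eq]
    tauto
  rw [Measure.map_apply (hh'.prodMk hW) (hU.prod hV),
    Measure.restrict_apply ((hh'.prodMk hW) (hU.prod hV)), Measure.smul_apply,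
    Measure.map_apply hh' hU, Measure.restrict_apply (hh' hU), smul_eq_mul]
  have h1 := congrArg (fun m : Measure (ℝ × ℝ) => m V) key
  rw [Measure.map_apply hW hV, Measure.restrict_apply (hW hV), Measure.prod_smul_left,
    Measure.smul_apply, smul_eq_mul] at h1
  rw [mul_comm (ENNReal.ofReal _), ← h1]
  congr 1
  ext ω
  simp only [Set.mem_inter_iff, Set.mem_preimage, Set.mem_prod, Set.mem_ofPred_eq]
  tauto

end IsModel

end GilbertElliot

/-! ### Decomposition by states and laws of consecutive cycles -/

namespace GilbertElliot

theorem sum_restrict_preimage {Ω β : Type*} [MeasurableSpace Ω] [Fintype β] [MeasurableSpace β]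
    [MeasurableSingletonClass β] (P : Measure Ω) {Y : Ω → β} (hY : Measurable Y) :
    ∑ y, P.restrict (Y ⁻¹' {y}) = P := by
  ext t ht
  rw [Measure.finsetSum_apply]
  simp_rw [Measure.restrict_apply ht, Set.inter_comm t]
  have h := sum_measure_preimage_singleton (μ := P.restrict t) Finset.univ (f := Y)
    fun y _ => hY (measurableSet_singleton y)
  simp_rw [Measure.restrict_apply (hY (measurableSet_singleton _))] at h
  rw [h]
  simp

variable {Ω : Type*} [MeasurableSpace Ω] {P : Measure Ω}
  {lam μb μg p q : ℝ} {A : ℕ → Ω → ℝ} {X : ℕ → Ω → ServerState} {S : ℕ → Ω → ℝ}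

namespace IsModel

variable (hM : IsModel P lam μb μg p q A X S)

include hM

theorem sum_restrict_state (n : ℕ) : ∑ s, P.restrict {ω | X n ω = s} = P :=
  sum_restrict_preimage P (hM.measurable_X n)

theorem sum_restrict_states (n : ℕ) :
    ∑ s, ∑ s', P.restrict {ω | X n ω = s ∧ X (n + 1) ω = s'} = P := by
  have h := sum_restrict_preimage P ((hM.measurable_X n).prodMk (hM.measurable_X (n + 1)))
  rw [Fintype.sum_prod_type] at h
  conv_rhs => rw [← h]
  refine Finset.sum_congr rfl fun s _ => Finset.sum_congr rfl fun s' _ => ?_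
  congr 1
  ext ω
  simp

theorem measure_states [IsProbabilityMeasure P] (hlam : 0 < lam) (hμb : 0 < μb)
    (hμg : 0 < μg) (n : ℕ) (s s' : ServerState) :
    P {ω | X n ω = s ∧ X (n + 1) ω = s'} =
      P {ω | X n ω = s} * ENNReal.ofReal (transition p q s s') := by
  have := isProbabilityMeasure_cycleLaw hlam hμb hμg s'
  have h := hM.measure_history_inter_box hlam n s s' .univ .univ (MeasurableSet.univ)
  rw [Set.univ_prod_univ, measure_univ, mul_one] at h
  simpa [Set.inter_def] using h

/-- Given the state, the service time and the idle period have the law `cycleLaw`. -/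
theorem map_cycleTimes [IsProbabilityMeasure P] (hlam : 0 < lam) (hμb : 0 < μb)
    (hμg : 0 < μg) (n : ℕ) (s : ServerState) :
    (P.restrict {ω | X n ω = s}).map (cycleTimes A S n) =
      P {ω | X n ω = s} • cycleLaw lam μb μg s := by
  have := isProbabilityMeasure_expMeasure hlam
  have := fun s => isProbabilityMeasure_expMeasure (serviceRate_pos hμb hμg s)
  have := isProbabilityMeasure_cycleLaw hlam hμb hμg s
  have hW := hM.measurable_cycleTimes n
  cases n with
  | zero =>
    rw [cycleLaw, ← Measure.prod_smul_left]
    have : IsFiniteMeasure (P {ω | X 0 ω = s} • expMeasure (serviceRate μb μg s)) :=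
      Measure.smul_finite _ (measure_ne_top _ _)
    refine (Measure.prod_eq fun B C hB hC => ?_).symm
    have h := hM.measure_historyEvent hlam 0 (fun _ => s) (fun _ => hB) (fun _ => hC)
    rw [zero_add, Finset.prod_range_one, cycleLaw, Measure.prod_prod, ← mul_assoc] at h
    rw [Measure.map_apply hW (hB.prod hC), Measure.restrict_apply (hW (hB.prod hC)),
      Measure.smul_apply, smul_eq_mul]
    simp only [Nat.le_zero, forall_eq] at h
    rw [← h]
    congr 1
    ext ω
    simp only [cycleTimes, historyEvent, Nat.le_zero, forall_eq, Set.mem_inter_iff,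
      Set.mem_preimage, Set.mem_prod, Set.mem_ofPred_eq]
    tauto
  | succ n =>
    -- Total probability over the previous state, with a trivial history variable. The prefactor is
    -- then identified by taking `V` to be everything.
    have key : ∀ V, MeasurableSet V → P ({ω | X (n + 1) ω = s} ∩ cycleTimes A S (n + 1) ⁻¹' V) =
        (∑ t, P {ω | X n ω = t} * ENNReal.ofReal (transition p q t s)) *
          cycleLaw lam μb μg s V := by
      intro V hV
      conv_lhs => rw [← hM.sum_restrict_state n]
      rw [Measure.finsetSum_apply, Finset.sum_mul]
      refine Finset.sum_congr rfl fun t _ => ?_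
      have h := hM.map_history_cycleTimes hlam hμb hμg n t s
        (h := fun _ => ()) measurable_const
      have h1 := congrArg (fun m : Measure (Unit × (ℝ × ℝ)) => m (Set.univ ×ˢ V)) h
      have hm : Measurable fun ω => ((), cycleTimes A S (n + 1) ω) := measurable_const.prodMk hW
      have : IsFiniteMeasure (ENNReal.ofReal (transition p q t s) •
        (P.restrict {ω | X n ω = t}).map (fun _ => ())) :=
          Measure.smul_finite _ ENNReal.ofReal_ne_top
      rw [Measure.map_apply hm (.prod .univ hV), Measure.restrict_apply (hm (.prod .univ hV)),
        Measure.prod_prod, Measure.smul_apply, Measure.map_apply measurable_const .univ,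
        Set.preimage_univ, Measure.restrict_apply_univ, smul_eq_mul,
        mul_comm (ENNReal.ofReal _)] at h1
      rw [← h1, Measure.restrict_apply ((hM.measurableSet_state _ _).inter (hW hV))]
      congr 1
      ext ω
      simp
      tauto
    have h1 := key Set.univ .univ
    rw [measure_univ, mul_one, Set.preimage_univ, Set.inter_univ] at h1
    ext V hV
    rw [Measure.map_apply hW hV, Measure.restrict_apply (hW hV), Set.inter_comm, key V hV,
      ← h1, Measure.smul_apply, smul_eq_mul]

/-- Given two consecutive states, the times of the two cycles are independent, each with its law
`cycleLaw`. -/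
theorem map_cycleTimes_pair [IsProbabilityMeasure P] (hlam : 0 < lam) (hμb : 0 < μb)
    (hμg : 0 < μg) (n : ℕ) (s s' : ServerState) :
    (P.restrict {ω | X n ω = s ∧ X (n + 1) ω = s'}).map
        (fun ω => (cycleTimes A S n ω, cycleTimes A S (n + 1) ω)) =
      P {ω | X n ω = s ∧ X (n + 1) ω = s'} •
        (cycleLaw lam μb μg s).prod (cycleLaw lam μb μg s') := by
  have := isProbabilityMeasure_cycleLaw hlam hμb hμg s
  have := isProbabilityMeasure_cycleLaw hlam hμb hμg s'
  rw [hM.map_history_cycleTimes hlam hμb hμg n s s' (measurable_history_cycleTimes le_rfl),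
    hM.map_cycleTimes hlam hμb hμg, hM.measure_states hlam hμb hμg, smul_smul,
    Measure.prod_smul_left, mul_comm]

end IsModel

end GilbertElliot

/-! ### A strong law for orthogonal variables -/

namespace GilbertElliot

/-- Strong law of large numbers for orthogonal, uniformly square integrable variables. -/
theorem tendsto_average_of_orthogonal {Ω : Type*} [MeasurableSpace Ω] {P : Measure Ω}
    {d : ℕ → Ω → ℝ} (hd : ∀ i, MemLp (d i) 2 P)
    (horth : ∀ i j, i < j → ∫ ω, d i ω * d j ω ∂P = 0) {C : ℝ} (hC : ∀ i, ∫ ω, d i ω ^ 2 ∂P ≤ C) :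
    ∀ᵐ ω ∂P, Tendsto (fun n : ℕ => (∑ i ∈ Finset.range n, d i ω) / n) atTop (𝓝 0) := by
  have hC0 : 0 ≤ C := (integral_nonneg fun ω => sq_nonneg _).trans (hC 0)
  have hint : ∀ i j, Integrable (fun ω => d i ω * d j ω) P := fun i j => (hd i).integrable_mul (hd j)
  have hint2 : ∀ i, Integrable (fun ω => d i ω ^ 2) P := fun i => (hd i).integrable_sq
  have hne : ∀ i j, i ≠ j → ∫ ω, d i ω * d j ω ∂P = 0 := fun i j hij => by
    rcases lt_or_gt_of_ne hij with h | h
    · exact horth i j h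
    · simp_rw [mul_comm (d i _)]
      exact horth j i h
  -- Subsequence of squares: `M k` is the partial sum up to k², and `N k` bounds the variation of
  -- the partial sums until (k + 1)².
  set M : ℕ → Ω → ℝ := fun k ω => ∑ i ∈ Finset.range (k ^ 2), d i ω with hMdef
  set N : ℕ → Ω → ℝ := fun k ω => ∑ i ∈ Finset.Ico (k ^ 2) ((k + 1) ^ 2), |d i ω| with hNdef
  have hMsq : ∀ k ω, M k ω ^ 2 =
      ∑ i ∈ Finset.range (k ^ 2), ∑ j ∈ Finset.range (k ^ 2), d i ω * d j ω := fun k ω => by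
    rw [sq, hMdef, Finset.sum_mul_sum]
  have hMint : ∀ k, Integrable (fun ω => M k ω ^ 2) P := fun k => by
    simp_rw [hMsq]
    exact integrable_finsetSum _ fun i _ => integrable_finsetSum _ fun j _ => hint i j
  have hMbd : ∀ k, ∫ ω, M k ω ^ 2 ∂P ≤ (k : ℝ) ^ 2 * C := fun k => by
    simp_rw [hMsq]
    rw [integral_finsetSum _ fun i _ => integrable_finsetSum _ fun j _ => hint i j]
    calc _ = ∑ i ∈ Finset.range (k ^ 2), ∫ ω, d i ω ^ 2 ∂P := by
          refine Finset.sum_congr rfl fun i hi => ?_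
          rw [integral_finsetSum _ fun j _ => hint i j, Finset.sum_eq_single_of_mem i hi
            fun j _ hj => hne i j hj.symm]
          simp_rw [sq]
      _ ≤ ∑ i ∈ Finset.range (k ^ 2), C := Finset.sum_le_sum fun i _ => hC i
      _ = (k : ℝ) ^ 2 * C := by simp
  have hcard : ∀ k : ℕ, ((Finset.Ico (k ^ 2) ((k + 1) ^ 2)).card : ℝ) = 2 * k + 1 := fun k => by
    rw [Nat.card_Ico, Nat.cast_sub (by gcongr; omega)]
    push_cast
    ring
  have hNle : ∀ (k : ℕ) (ω : Ω), N k ω ^ 2 ≤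
      (2 * k + 1) * ∑ i ∈ Finset.Ico (k ^ 2) ((k + 1) ^ 2), d i ω ^ 2 := fun k ω => by
    have := sq_sum_le_card_mul_sum_sq (s := Finset.Ico (k ^ 2) ((k + 1) ^ 2))
      (f := fun i => |d i ω|)
    simpa only [hcard, sq_abs] using this
  have hNint : ∀ k : ℕ, Integrable (fun ω =>
      (2 * (k : ℝ) + 1) * ∑ i ∈ Finset.Ico (k ^ 2) ((k + 1) ^ 2), d i ω ^ 2) P := fun k =>
    (integrable_finsetSum _ fun i _ => hint2 i).const_mul _
  set Z : ℕ → Ω → ℝ := fun k ω => (M k ω ^ 2 +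
    (2 * (k : ℝ) + 1) * ∑ i ∈ Finset.Ico (k ^ 2) ((k + 1) ^ 2), d i ω ^ 2) / (k + 1) ^ 4 with hZ
  have hZ0 : ∀ k ω, 0 ≤ Z k ω := fun k ω => by positivity
  have hZint : ∀ k, Integrable (Z k) P := fun k => ((hMint k).add (hNint k)).div_const _
  have hZbd : ∀ k, ∫ ω, Z k ω ∂P ≤ 5 * C * (1 / ((k : ℝ) + 1) ^ 2) := fun k => by
    rw [hZ]
    simp only
    rw [integral_div, integral_add (hMint k) (hNint k), integral_const_mul,
      integral_finsetSum _ fun i _ => hint2 i, div_le_iff₀ (by positivity)]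
    have h1 : ∑ i ∈ Finset.Ico (k ^ 2) ((k + 1) ^ 2), ∫ ω, d i ω ^ 2 ∂P ≤ (2 * k + 1) * C := by
      calc _ ≤ ∑ i ∈ Finset.Ico (k ^ 2) ((k + 1) ^ 2), C := Finset.sum_le_sum fun i _ => hC i
        _ = _ := by rw [Finset.sum_const, nsmul_eq_mul, hcard]
    have hk : (0 : ℝ) ≤ k := k.cast_nonneg
    calc _ ≤ (k : ℝ) ^ 2 * C + (2 * k + 1) * ((2 * k + 1) * C) := by
          gcongr
          exact hMbd k
      -- The constant 5 comes from k² + (2k + 1)² ≤ 5(k + 1)².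
      _ ≤ 5 * C * (k + 1) ^ 2 := by nlinarith [mul_nonneg hC0 hk]
      _ = 5 * C * (1 / ((k : ℝ) + 1) ^ 2) * (k + 1) ^ 4 := by field_simp
  have hsum : Summable fun k : ℕ => 5 * C * (1 / ((k : ℝ) + 1) ^ 2) := by
    refine Summable.mul_left _ ?_
    have := (summable_nat_add_iff 1).2 (Real.summable_one_div_nat_pow.2 one_lt_two)
    simpa using this
  -- The means of `Z k` are summable, so almost surely the series of the `Z k` converges and its
  -- terms tend to 0.
  have hfin : ∫⁻ ω, ∑' k, ENNReal.ofReal (Z k ω) ∂P ≠ ⊤ := by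
    rw [lintegral_tsum fun k => (hZint k).aestronglyMeasurable.aemeasurable.ennreal_ofReal]
    refine ne_top_of_le_ne_top hsum.tsum_ofReal_ne_top (ENNReal.tsum_le_tsum fun k => ?_)
    rw [← ofReal_integral_eq_lintegral_ofReal (hZint k) (.of_forall fun ω => hZ0 k ω)]
    exact ENNReal.ofReal_le_ofReal (hZbd k)
  have hmeas : AEMeasurable (fun ω => ∑' k, ENNReal.ofReal (Z k ω)) P :=
    AEMeasurable.tsum fun k =>
      (hZint k).aestronglyMeasurable.aemeasurable.ennreal_ofReal
  filter_upwards [ae_lt_top' hmeas hfin] with ω hω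
  have hZt : Tendsto (fun k => Z k ω) atTop (𝓝 0) := by
    have h1 := ENNReal.tendsto_atTop_zero_of_tsum_ne_top hω.ne
    have h2 := (ENNReal.tendsto_toReal ENNReal.zero_ne_top).comp h1
    refine h2.congr fun k => ?_
    simp [ENNReal.toReal_ofReal (hZ0 k ω)]
  have hsqrt : Tendsto Nat.sqrt atTop atTop :=
    tendsto_atTop.2 fun b => by
      filter_upwards [eventually_ge_atTop (b * b)] with n hn using Nat.le_sqrt.2 hn
  -- 32 = 2 · 16: the 2 from (x + y)² ≤ 2(x² + y²), the 16 from (k + 1)⁴ ≤ (2k)⁴ ≤ 16 n² with k the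
  -- integer square root of n.
  have hlim : Tendsto (fun n : ℕ => √(32 * Z (Nat.sqrt n) ω)) atTop (𝓝 0) := by
    have h := ((hZt.comp hsqrt).const_mul 32).sqrt
    simpa using h
  refine squeeze_zero_norm' ?_ hlim
  filter_upwards [eventually_ge_atTop 1] with n hn
  set k := Nat.sqrt n with hk
  have hk1 : 1 ≤ k := Nat.le_sqrt.2 (by simpa using hn)
  have hkn : k ^ 2 ≤ n := Nat.sqrt_le' n
  have hnk : n ≤ (k + 1) ^ 2 := (Nat.lt_succ_sqrt' n).le
  have hb : |∑ i ∈ Finset.range n, d i ω| ≤ |M k ω| + N k ω := by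
    rw [← Finset.sum_range_add_sum_Ico _ hkn]
    refine (abs_add_le _ _).trans (add_le_add le_rfl ((Finset.abs_sum_le_sum_abs _ _).trans ?_))
    exact Finset.sum_le_sum_of_subset_of_nonneg (Finset.Ico_subset_Ico_right hnk)
      fun _ _ _ => abs_nonneg _
  have hn0 : (0 : ℝ) < n := by exact_mod_cast hn
  have hk0 : (1 : ℝ) ≤ k := by exact_mod_cast hk1
  have hkn' : (k : ℝ) ^ 2 ≤ n := by exact_mod_cast hkn
  rw [Real.norm_eq_abs]
  refine Real.le_sqrt_of_sq_le ?_
  rw [sq_abs, div_pow, ← sq_abs (∑ i ∈ Finset.range n, d i ω), div_le_iff₀ (by positivity)]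
  have hZk : M k ω ^ 2 + N k ω ^ 2 ≤ Z k ω * (k + 1) ^ 4 := by
    rw [hZ]
    simp only
    rw [div_mul_cancel₀ _ (by positivity)]
    linarith [hNle k ω]
  have hk4 : ((k : ℝ) + 1) ^ 4 ≤ 16 * (n : ℝ) ^ 2 := by
    calc ((k : ℝ) + 1) ^ 4 ≤ (2 * (k : ℝ)) ^ 4 := by gcongr; linarith
      _ = 16 * ((k : ℝ) ^ 2) ^ 2 := by ring
      _ ≤ 16 * (n : ℝ) ^ 2 := by gcongr
  calc |∑ i ∈ Finset.range n, d i ω| ^ 2 ≤ (|M k ω| + N k ω) ^ 2 := by gcongr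
    _ ≤ 2 * (M k ω ^ 2 + N k ω ^ 2) := by
      rw [← sq_abs (M k ω)]
      nlinarith [sq_nonneg (|M k ω| - N k ω)]
    _ ≤ 2 * (Z k ω * (16 * (n : ℝ) ^ 2)) := by
      have := mul_le_mul_of_nonneg_left hk4 (hZ0 k ω)
      linarith
    _ = 32 * Z k ω * (n : ℝ) ^ 2 := by ring

end GilbertElliot

/-! ### Observables of two consecutive cycles -/

namespace GilbertElliot

/-- Observable of two consecutive states and the times of their cycles. -/
abbrev PairObservable := ServerState → ServerState → ℝ × ℝ → ℝ × ℝ → ℝ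

/-- Value of an observable at the cycles `n` and `n + 1`. -/
noncomputable def pairValue {Ω : Type*} (A : ℕ → Ω → ℝ) (X : ℕ → Ω → ServerState)
    (S : ℕ → Ω → ℝ) (F : PairObservable) (n : ℕ) (ω : Ω) : ℝ :=
  F (X n ω) (X (n + 1) ω) (cycleTimes A S n ω) (cycleTimes A S (n + 1) ω)

theorem measurable_pairValue {Ω : Type*} [MeasurableSpace Ω] {A : ℕ → Ω → ℝ}
    {X : ℕ → Ω → ServerState} {S : ℕ → Ω → ℝ} {F : PairObservable}
    (hF : ∀ s s', Measurable fun z : (ℝ × ℝ) × (ℝ × ℝ) => F s s' z.1 z.2) {n : ℕ}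
    (hX : Measurable (X n)) (hX' : Measurable (X (n + 1)))
    (hW : Measurable (cycleTimes A S n)) (hW' : Measurable (cycleTimes A S (n + 1))) :
    Measurable (pairValue A X S F n) := by
  refine measurable_state_of_discrete (f := fun s ω =>
    F s (X (n + 1) ω) (cycleTimes A S n ω) (cycleTimes A S (n + 1) ω)) (fun s => ?_) hX
  refine measurable_state_of_discrete (f := fun s' ω =>
    F s s' (cycleTimes A S n ω) (cycleTimes A S (n + 1) ω)) (fun s' => ?_) hX'
  exact (hF s s').comp (hW.prodMk hW')

/-- The value at `m` involves cycle m + 1, hence the strict inequality. -/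
theorem measurable_history_pairValue {Ω : Type*} {A : ℕ → Ω → ℝ}
    {X : ℕ → Ω → ServerState} {S : ℕ → Ω → ℝ} {F : PairObservable}
    (hF : ∀ s s', Measurable fun z : (ℝ × ℝ) × (ℝ × ℝ) => F s s' z.1 z.2) {m n : ℕ}
    (hmn : m < n) : Measurable[history A X S n] (pairValue A X S F m) :=
  @measurable_pairValue Ω (history A X S n) A X S F hF m
    (measurable_history_state hmn.le) (measurable_history_state hmn)
    (measurable_history_cycleTimes hmn.le) (measurable_history_cycleTimes hmn)

theorem transition_pos {p q : ℝ} (hp : p ∈ Set.Ioo (0 : ℝ) 1) (hq : q ∈ Set.Ioo (0 : ℝ) 1)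
    (s s' : ServerState) : 0 < transition p q s s' := by
  cases s <;> cases s' <;> simp [transition, hp.1, hp.2, hq.1, hq.2]

variable {Ω : Type*} [MeasurableSpace Ω] {P : Measure Ω}
  {lam μb μg p q : ℝ} {A : ℕ → Ω → ℝ} {X : ℕ → Ω → ServerState} {S : ℕ → Ω → ℝ}

namespace IsModel

variable (hM : IsModel P lam μb μg p q A X S)

include hM

theorem measurable_pairValue {F : PairObservable}
    (hF : ∀ s s', Measurable fun z : (ℝ × ℝ) × (ℝ × ℝ) => F s s' z.1 z.2) (n : ℕ) :
    Measurable (pairValue A X S F n) :=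
  GilbertElliot.measurable_pairValue hF (hM.measurable_X n) (hM.measurable_X _)
    (hM.measurable_cycleTimes n) (hM.measurable_cycleTimes _)

theorem ae_restrict_pairValue (F : PairObservable) (n : ℕ) (s s' : ServerState) :
    ∀ᵐ ω ∂(P.restrict {ω | X n ω = s ∧ X (n + 1) ω = s'}),
      pairValue A X S F n ω = F s s' (cycleTimes A S n ω) (cycleTimes A S (n + 1) ω) := by
  filter_upwards [ae_restrict_mem (hM.measurableSet_states n s s')] with ω hω
  rw [pairValue, hω.1, hω.2]

theorem integral_eq_sum_states {f : Ω → ℝ} (hf : Integrable f P) (n : ℕ) :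
    ∫ ω, f ω ∂P = ∑ s, ∑ s', ∫ ω in {ω | X n ω = s ∧ X (n + 1) ω = s'}, f ω ∂P := by
  conv_lhs => rw [← hM.sum_restrict_states n]
  rw [integral_finsetSum_measure fun s _ => integrable_finsetSum_measure.2 fun s' _ =>
    hf.mono_measure Measure.restrict_le_self]
  exact Finset.sum_congr rfl fun s _ => integral_finsetSum_measure fun s' _ =>
    hf.mono_measure Measure.restrict_le_self

variable [IsProbabilityMeasure P] (hlam : 0 < lam) (hμb : 0 < μb) (hμg : 0 < μg)

include hlam hμb hμg

theorem integrableOn_pairValue {F : PairObservable} {s s' : ServerState}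
    (hF : Integrable (fun z : (ℝ × ℝ) × (ℝ × ℝ) => F s s' z.1 z.2)
      ((cycleLaw lam μb μg s).prod (cycleLaw lam μb μg s'))) (n : ℕ) :
    IntegrableOn (pairValue A X S F n) {ω | X n ω = s ∧ X (n + 1) ω = s'} P := by
  have hW := (hM.measurable_cycleTimes n).prodMk (hM.measurable_cycleTimes (n + 1))
  have h : Integrable (fun z : (ℝ × ℝ) × (ℝ × ℝ) => F s s' z.1 z.2)
      ((P.restrict {ω | X n ω = s ∧ X (n + 1) ω = s'}).map
        (fun ω => (cycleTimes A S n ω, cycleTimes A S (n + 1) ω))) := by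
    rw [hM.map_cycleTimes_pair hlam hμb hμg]
    exact hF.smul_measure (measure_ne_top _ _)
  refine (h.comp_measurable hW).congr ?_
  filter_upwards [hM.ae_restrict_pairValue F n s s'] with ω hω
  rw [hω]
  rfl

theorem setIntegral_pairValue {F : PairObservable} {s s' : ServerState}
    (hF : Measurable fun z : (ℝ × ℝ) × (ℝ × ℝ) => F s s' z.1 z.2) (n : ℕ) :
    ∫ ω in {ω | X n ω = s ∧ X (n + 1) ω = s'}, pairValue A X S F n ω ∂P =
      P.real {ω | X n ω = s ∧ X (n + 1) ω = s'} * ∫ z : (ℝ × ℝ) × (ℝ × ℝ), F s s' z.1 z.2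
        ∂((cycleLaw lam μb μg s).prod (cycleLaw lam μb μg s')) := by
  have hW := (hM.measurable_cycleTimes n).prodMk (hM.measurable_cycleTimes (n + 1))
  rw [integral_congr_ae (hM.ae_restrict_pairValue F n s s'), ← smul_eq_mul, Measure.real,
    ← integral_smul_measure, ← hM.map_cycleTimes_pair hlam hμb hμg,
    integral_map hW.aemeasurable hF.aestronglyMeasurable]

theorem integrable_pairValue {F : PairObservable}
    (hF : ∀ s s', Integrable (fun z : (ℝ × ℝ) × (ℝ × ℝ) => F s s' z.1 z.2)
      ((cycleLaw lam μb μg s).prod (cycleLaw lam μb μg s'))) (n : ℕ) :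
    Integrable (pairValue A X S F n) P := by
  rw [← hM.sum_restrict_states n]
  exact integrable_finsetSum_measure.2 fun s _ => integrable_finsetSum_measure.2 fun s' _ =>
    hM.integrableOn_pairValue hlam hμb hμg (hF s s') n

theorem integral_pairValue {F : PairObservable}
    (hFm : ∀ s s', Measurable fun z : (ℝ × ℝ) × (ℝ × ℝ) => F s s' z.1 z.2)
    (hF : ∀ s s', Integrable (fun z : (ℝ × ℝ) × (ℝ × ℝ) => F s s' z.1 z.2)
      ((cycleLaw lam μb μg s).prod (cycleLaw lam μb μg s'))) (n : ℕ) :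
    ∫ ω, pairValue A X S F n ω ∂P = ∑ s, ∑ s', P.real {ω | X n ω = s ∧ X (n + 1) ω = s'} *
      ∫ z : (ℝ × ℝ) × (ℝ × ℝ), F s s' z.1 z.2
        ∂((cycleLaw lam μb μg s).prod (cycleLaw lam μb μg s')) := by
  rw [hM.integral_eq_sum_states (hM.integrable_pairValue hlam hμb hμg hF n) n]
  exact Finset.sum_congr rfl fun s _ => Finset.sum_congr rfl fun s' _ =>
    hM.setIntegral_pairValue hlam hμb hμg (hFm s s') n

theorem integrable_pairValue_sq {F : PairObservable}
    (hF : ∀ s s', MemLp (fun z : (ℝ × ℝ) × (ℝ × ℝ) => F s s' z.1 z.2) 2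
      ((cycleLaw lam μb μg s).prod (cycleLaw lam μb μg s'))) (n : ℕ) :
    Integrable (fun ω => pairValue A X S F n ω ^ 2) P :=
  hM.integrable_pairValue (F := fun s s' w w' => F s s' w w' ^ 2) hlam hμb hμg
    (fun s s' => (hF s s').integrable_sq) n

theorem memLp_pairValue {F : PairObservable}
    (hFm : ∀ s s', Measurable fun z : (ℝ × ℝ) × (ℝ × ℝ) => F s s' z.1 z.2)
    (hF : ∀ s s', MemLp (fun z : (ℝ × ℝ) × (ℝ × ℝ) => F s s' z.1 z.2) 2
      ((cycleLaw lam μb μg s).prod (cycleLaw lam μb μg s'))) (n : ℕ) :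
    MemLp (pairValue A X S F n) 2 P :=
  (memLp_two_iff_integrable_sq (hM.measurable_pairValue hFm n).aestronglyMeasurable).2
    (hM.integrable_pairValue_sq hlam hμb hμg hF n)

/-- An observable whose conditional mean vanishes is orthogonal to the history. -/
theorem integral_history_mul_pairValue (hp : p ∈ Set.Ioo (0 : ℝ) 1) (hq : q ∈ Set.Ioo (0 : ℝ) 1)
    {F : PairObservable}
    (hFm : ∀ s s', Measurable fun z : (ℝ × ℝ) × (ℝ × ℝ) => F s s' z.1 z.2)
    (hF : ∀ s s', MemLp (fun z : (ℝ × ℝ) × (ℝ × ℝ) => F s s' z.1 z.2) 2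
      ((cycleLaw lam μb μg s).prod (cycleLaw lam μb μg s')))
    (hF0 : ∀ s w, ∑ s', transition p q s s' * ∫ w', F s s' w w' ∂(cycleLaw lam μb μg s') = 0)
    (n : ℕ) {Y : Ω → ℝ} (hY : Measurable[history A X S n] Y) (hY2 : MemLp Y 2 P) :
    ∫ ω, Y ω * pairValue A X S F n ω ∂P = 0 := by
  have := fun s => isProbabilityMeasure_cycleLaw hlam hμb hμg s
  have hint : Integrable (fun ω => Y ω * pairValue A X S F n ω) P :=
    hY2.integrable_mul (hM.memLp_pairValue hlam hμb hμg hFm hF n)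
  rw [hM.integral_eq_sum_states hint n]
  refine Finset.sum_eq_zero fun s _ => ?_
  have hW := hM.measurable_cycleTimes n
  have hW' := hM.measurable_cycleTimes (n + 1)
  have hYm : Measurable Y := hY.mono (hM.history_le n) le_rfl
  have hh : Measurable[history A X S n] fun ω => (Y ω, cycleTimes A S n ω) :=
    hY.prodMk (measurable_history_cycleTimes le_rfl)
  have hh' : Measurable fun ω => (Y ω, cycleTimes A S n ω) := hYm.prodMk hW
  have hG : ∀ s', Measurable fun z : (ℝ × (ℝ × ℝ)) × (ℝ × ℝ) => z.1.1 * F s s' z.1.2 z.2 :=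
    fun s' => (measurable_fst.comp measurable_fst).mul ((hFm s s').comp
      ((measurable_snd.comp measurable_fst).prodMk measurable_snd))
  have hG' : ∀ s', Measurable fun h : ℝ × (ℝ × ℝ) =>
      ∫ w', h.1 * F s s' h.2 w' ∂(cycleLaw lam μb μg s') := fun s' =>
    ((hG s').stronglyMeasurable.integral_prod_right (ν := cycleLaw lam μb μg s')).measurable
  have hT := transition_pos hp hq s
  have hGint : ∀ s', Integrable (fun z : (ℝ × (ℝ × ℝ)) × (ℝ × ℝ) => z.1.1 * F s s' z.1.2 z.2)
      ((ENNReal.ofReal (transition p q s s') • (P.restrict {ω | X n ω = s}).map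
        fun ω => (Y ω, cycleTimes A S n ω)).prod (cycleLaw lam μb μg s')) := fun s' => by
    rw [← hM.map_history_cycleTimes hlam hμb hμg n s s' hh, integrable_map_measure
      (hG s').aestronglyMeasurable (hh'.prodMk hW').aemeasurable]
    refine (hint.mono_measure Measure.restrict_le_self).congr ?_
    filter_upwards [hM.ae_restrict_pairValue F n s s'] with ω hω
    rw [hω]
    rfl
  -- The Markov property makes the next cycle an independent factor, which is integrated out with
  -- the history held fixed.
  have step : ∀ s', ∫ ω in {ω | X n ω = s ∧ X (n + 1) ω = s'}, Y ω * pairValue A X S F n ω ∂P =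
      ∫ ω in {ω | X n ω = s}, transition p q s s' *
        ∫ w', Y ω * F s s' (cycleTimes A S n ω) w' ∂(cycleLaw lam μb μg s') ∂P := fun s' => by
    have h1 : ∫ ω in {ω | X n ω = s ∧ X (n + 1) ω = s'}, Y ω * pairValue A X S F n ω ∂P =
        ∫ z : (ℝ × (ℝ × ℝ)) × (ℝ × ℝ), z.1.1 * F s s' z.1.2 z.2
          ∂((P.restrict {ω | X n ω = s ∧ X (n + 1) ω = s'}).map
            (fun ω => ((Y ω, cycleTimes A S n ω), cycleTimes A S (n + 1) ω))) := by
      rw [integral_map (hh'.prodMk hW').aemeasurable (hG s').aestronglyMeasurable]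
      refine integral_congr_ae ?_
      filter_upwards [hM.ae_restrict_pairValue F n s s'] with ω hω
      rw [hω]
    have : IsFiniteMeasure (ENNReal.ofReal (transition p q s s') •
      (P.restrict {ω | X n ω = s}).map fun ω => (Y ω, cycleTimes A S n ω)) :=
        Measure.smul_finite _ ENNReal.ofReal_ne_top
    rw [h1, hM.map_history_cycleTimes hlam hμb hμg n s s' hh, integral_prod _ (hGint s'),
      integral_smul_measure, ENNReal.toReal_ofReal (hT s').le,
      integral_map hh'.aemeasurable (hG' s').aestronglyMeasurable, integral_const_mul, smul_eq_mul]
  have stepint : ∀ s', Integrable (fun ω => transition p q s s' *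
        ∫ w', Y ω * F s s' (cycleTimes A S n ω) w' ∂(cycleLaw lam μb μg s'))
      (P.restrict {ω | X n ω = s}) := fun s' => by
    have : IsFiniteMeasure (ENNReal.ofReal (transition p q s s') •
      (P.restrict {ω | X n ω = s}).map fun ω => (Y ω, cycleTimes A S n ω)) :=
        Measure.smul_finite _ ENNReal.ofReal_ne_top
    have h := (hGint s').integral_prod_left
    -- A positive transition probability lets integrability pass to the measure without the scalar.
    rw [integrable_smul_measure (by simpa using hT s') ENNReal.ofReal_ne_top,
      integrable_map_measure (hG' s').aestronglyMeasurable hh'.aemeasurable] at h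
    exact h.const_mul _
  rw [Finset.sum_congr rfl fun s' _ => step s', ← integral_finsetSum _ fun s' _ => stepint s']
  refine integral_eq_zero_of_ae (.of_forall fun ω => ?_)
  -- The history variable factors out of the sum over next states, leaving the vanishing conditional
  -- mean.
  simp_rw [integral_const_mul, mul_left_comm _ (Y ω)]
  rw [← Finset.mul_sum, hF0, mul_zero]
  rfl

/-- Law of large numbers for observables whose conditional mean vanishes. -/
theorem tendsto_average_pairValue_zero (hp : p ∈ Set.Ioo (0 : ℝ) 1) (hq : q ∈ Set.Ioo (0 : ℝ) 1)
    {F : PairObservable}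
    (hFm : ∀ s s', Measurable fun z : (ℝ × ℝ) × (ℝ × ℝ) => F s s' z.1 z.2)
    (hF : ∀ s s', MemLp (fun z : (ℝ × ℝ) × (ℝ × ℝ) => F s s' z.1 z.2) 2
      ((cycleLaw lam μb μg s).prod (cycleLaw lam μb μg s')))
    (hF0 : ∀ s w, ∑ s', transition p q s s' * ∫ w', F s s' w w' ∂(cycleLaw lam μb μg s') = 0) :
    ∀ᵐ ω ∂P, Tendsto (fun n : ℕ => (∑ i ∈ Finset.range n, pairValue A X S F i ω) / n)
      atTop (𝓝 0) := by
  have hmem := hM.memLp_pairValue hlam hμb hμg hFm hF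
  refine tendsto_average_of_orthogonal hmem (fun i j hij =>
    hM.integral_history_mul_pairValue hlam hμb hμg hp hq hFm hF hF0 j
      (measurable_history_pairValue hFm hij) (hmem i))
    -- The second moment at any index is a weighted sum of these finitely many moments, with
    -- probabilities as weights.
    (C := ∑ s, ∑ s', ∫ z : (ℝ × ℝ) × (ℝ × ℝ), F s s' z.1 z.2 ^ 2
        ∂((cycleLaw lam μb μg s).prod (cycleLaw lam μb μg s'))) fun n => ?_
  have h := hM.integral_pairValue (F := fun s s' w w' => F s s' w w' ^ 2) hlam hμb hμg
    (fun s s' => (hFm s s').pow_const 2) (fun s s' => (hF s s').integrable_sq) n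
  change ∫ ω, pairValue A X S (fun s s' w w' => F s s' w w' ^ 2) n ω ∂P ≤ _
  rw [h]
  refine Finset.sum_le_sum fun s _ => Finset.sum_le_sum fun s' _ => ?_
  exact mul_le_of_le_one_left (integral_nonneg fun z => sq_nonneg _) measureReal_le_one

end IsModel

end GilbertElliot

namespace GilbertElliot

/-! ### Sample paths of the age -/

theorem integral_sub_const (a b c : ℝ) :
    ∫ t in a..b, (t - c) = ((b - c) ^ 2 - (a - c) ^ 2) / 2 := by
  rw [intervalIntegral.integral_comp_sub_right (fun t => t), integral_id]

section Path

variable {A S : ℕ → ℝ} {u₀ : ℝ}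

theorem entryTime_succ (A S : ℕ → ℝ) (j : ℕ) :
    entryTime A S (j + 1) = entryTime A S j + S j + idleTime A S j := by
  rw [idleTime, deliveryTime]
  ring

theorem cycleLength_eq (A S : ℕ → ℝ) (j : ℕ) : cycleLength A S j = S j + idleTime A S j := by
  rw [cycleLength, entryTime_succ]
  ring

theorem deliveryTime_eq_sum (A S : ℕ → ℝ) (n : ℕ) :
    deliveryTime A S n = entryTime A S 0 + ∑ j ∈ Finset.range n, cycleLength A S j + S n := by
  have h := Finset.sum_range_sub (entryTime A S) n
  unfold cycleLength deliveryTime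
  linarith

variable (hA : RegularArrivals A) (hS : ∀ j, 0 < S j)

include hA in
theorem entryTime_zero_pos : 0 < entryTime A S 0 := by
  simpa [entryTime, entryIndex, arrivalTime] using hA.pos 0

include hS in
theorem entryTime_lt_deliveryTime (j : ℕ) : entryTime A S j < deliveryTime A S j := by
  rw [deliveryTime]
  linarith [hS j]

include hS in
theorem age_nonneg (hu₀ : u₀ ≤ 0) {t : ℝ} (ht : 0 ≤ t) : 0 ≤ age u₀ A S t := by
  refine sub_nonneg.2 (csSup_le (Set.insert_nonempty _ _) ?_)
  rintro u (rfl | ⟨i, hi, rfl⟩)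
  · exact hu₀.trans ht
  · exact (entryTime_lt_deliveryTime hS i).le.trans hi

include hA hS

theorem deliveryTime_lt_entryTime_succ (j : ℕ) : deliveryTime A S j < entryTime A S (j + 1) := by
  rw [entryTime_succ, deliveryTime]
  linarith [idleTime_pos hA j (hS j).le]

theorem entryTime_strictMono : StrictMono (entryTime A S) :=
  strictMono_nat_of_lt_succ fun j =>
    (entryTime_lt_deliveryTime hS j).trans (deliveryTime_lt_entryTime_succ hA hS j)

theorem deliveryTime_strictMono : StrictMono (deliveryTime A S) :=
  strictMono_nat_of_lt_succ fun j =>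
    (deliveryTime_lt_entryTime_succ hA hS j).trans (entryTime_lt_deliveryTime hS (j + 1))

/-- Entry times form a subsequence of the arrival times, so no growth of the service times is
needed. -/
theorem tendsto_deliveryTime : Tendsto (deliveryTime A S) atTop atTop := by
  have hmono : StrictMono (entryIndex A S) := strictMono_nat_of_lt_succ fun j => by
    obtain ⟨k, hk, -⟩ := entryIndex_succ hA j (hS j).le
    omega
  have h : Tendsto (arrivalTime A) atTop atTop := hA.unbounded.comp (tendsto_add_atTop_nat 1)
  refine tendsto_atTop_mono (fun j => ?_) (h.comp hmono.tendsto_atTop)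
  exact (entryTime_lt_deliveryTime hS j).le

/-- Entry and delivery times have the same order, so the latest delivered packet is the freshest; it
beats `u₀` because entry times are positive. -/
theorem freshestStamp_eq_entryTime (hu₀ : u₀ ≤ 0) {j : ℕ} {t : ℝ} (h1 : deliveryTime A S j ≤ t)
    (h2 : t < deliveryTime A S (j + 1)) : freshestStamp u₀ A S t = entryTime A S j := by
  refine IsGreatest.csSup_eq ⟨Or.inr ⟨j, h1, rfl⟩, ?_⟩
  rintro u (rfl | ⟨i, hi, rfl⟩)
  · exact hu₀.trans ((entryTime_zero_pos hA).le.trans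
      ((entryTime_strictMono hA hS).monotone (Nat.zero_le j)))
  · refine (entryTime_strictMono hA hS).monotone (Nat.lt_succ_iff.1 ?_)
    exact (deliveryTime_strictMono hA hS).lt_iff_lt.1 (hi.trans_lt h2)

theorem freshestStamp_eq_initial {t : ℝ} (h : t < deliveryTime A S 0) :
    freshestStamp u₀ A S t = u₀ := by
  refine IsGreatest.csSup_eq ⟨Or.inl rfl, ?_⟩
  rintro u (rfl | ⟨i, hi, rfl⟩)
  · exact le_rfl
  · exact absurd (hi.trans_lt h) (not_lt.2 ((deliveryTime_strictMono hA hS).monotone (Nat.zero_le i)))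

theorem freshestStamp_le (hu₀ : u₀ ≤ 0) {j : ℕ} {t : ℝ} (h : t < deliveryTime A S j) :
    freshestStamp u₀ A S t ≤ entryTime A S j := by
  refine csSup_le (Set.insert_nonempty _ _) ?_
  rintro u (rfl | ⟨i, hi, rfl⟩)
  · exact hu₀.trans ((entryTime_zero_pos hA).le.trans
      ((entryTime_strictMono hA hS).monotone (Nat.zero_le j)))
  · exact (entryTime_strictMono hA hS).monotone
      ((deliveryTime_strictMono hA hS).lt_iff_lt.1 (hi.trans_lt h)).le

theorem age_eqOn (hu₀ : u₀ ≤ 0) (j : ℕ) :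
    Set.EqOn (age u₀ A S) (fun t => t - entryTime A S j)
      (Set.Ioo (deliveryTime A S j) (deliveryTime A S (j + 1))) := fun t ht => by
  rw [age, freshestStamp_eq_entryTime hA hS hu₀ ht.1.le ht.2]

/-- The area of a cycle in terms of its length and of the next service time. -/
theorem cycleArea_eq (hu₀ : u₀ ≤ 0) (j : ℕ) :
    cycleArea u₀ A S j = 1 / 2 * (S j + idleTime A S j) ^ 2 +
      (S j + idleTime A S j) * S (j + 1) := by
  set T := entryTime A S j with hT
  set T' := entryTime A S (j + 1) with hT'
  set D := deliveryTime A S (j + 1) with hD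
  have hTT' : T < T' := entryTime_strictMono hA hS (Nat.lt_succ_self j)
  have hTD : T' < D := entryTime_lt_deliveryTime hS (j + 1)
  have h1 : cycleArea u₀ A S j = ∫ t in T..D, ((t - T) - max 0 (t - T')) := by
    rw [cycleArea]
    refine intervalIntegral.integral_congr_Ioo_of_le (hTT'.trans hTD).le fun t ht => ?_
    -- Before delivery `j` the age lies on or above the line through (T, 0), since no later stamp is
    -- known; afterwards it follows this line until the next delivery.
    have hmin : min (age u₀ A S t) (t - T) = t - T := by
      refine min_eq_right ?_
      rw [age]
      rcases lt_or_ge t (deliveryTime A S j) with h | h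
      · linarith [freshestStamp_le hA hS hu₀ h]
      · rw [freshestStamp_eq_entryTime hA hS hu₀ h ht.2]
    exact congrArg (· - max 0 (t - T')) hmin
  have hi1 : IntervalIntegrable (fun t : ℝ => t - T) volume T D :=
    Continuous.intervalIntegrable (by fun_prop) _ _
  have hc : Continuous fun t : ℝ => max 0 (t - T') := by fun_prop
  have h2 : ∫ t in T..T', max 0 (t - T') = 0 := by
    rw [intervalIntegral.integral_congr (g := fun _ => (0 : ℝ)) fun t ht => ?_]
    · simp
    · rw [Set.uIcc_of_le hTT'.le] at ht
      exact max_eq_left (by linarith [ht.2])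
  have h3 : ∫ t in T'..D, max 0 (t - T') = ∫ t in T'..D, (t - T') :=
    intervalIntegral.integral_congr fun t ht => by
      rw [Set.uIcc_of_le hTD.le] at ht
      exact max_eq_right (by linarith [ht.1])
  rw [h1, intervalIntegral.integral_sub hi1 (hc.intervalIntegrable _ _),
    ← intervalIntegral.integral_add_adjacent_intervals (hc.intervalIntegrable T T')
      (hc.intervalIntegrable T' D), h2, h3]
  rw [integral_sub_const, integral_sub_const]
  have e1 : T' = T + (S j + idleTime A S j) := by rw [hT', entryTime_succ]; ring
  have e2 : D = T' + S (j + 1) := rfl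
  rw [e2, e1]
  ring

theorem intervalIntegrable_age_cycle (hu₀ : u₀ ≤ 0) (j : ℕ) :
    IntervalIntegrable (age u₀ A S) volume (deliveryTime A S j) (deliveryTime A S (j + 1)) := by
  have h : IntervalIntegrable (fun t => t - entryTime A S j) volume (deliveryTime A S j)
    (deliveryTime A S (j + 1)) := Continuous.intervalIntegrable (by fun_prop) _ _
  refine h.congr_ae ?_
  rw [Set.uIoc_of_le (deliveryTime_strictMono hA hS (Nat.lt_succ_self j)).le,
    ← restrict_Ioo_eq_restrict_Ioc]
  exact (ae_restrict_mem measurableSet_Ioo).mono fun t ht => (age_eqOn hA hS hu₀ j ht).symm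

/-- Cutting at deliveries instead of along lines of slope one adds one triangle and removes another.
These corrections telescope when summed over cycles. -/
theorem integral_age_cycle (hu₀ : u₀ ≤ 0) (j : ℕ) :
    ∫ t in (deliveryTime A S j)..(deliveryTime A S (j + 1)), age u₀ A S t =
      cycleArea u₀ A S j + (S (j + 1) ^ 2 / 2 - S j ^ 2 / 2) := by
  rw [intervalIntegral.integral_congr_Ioo_of_le
    (deliveryTime_strictMono hA hS (Nat.lt_succ_self j)).le (age_eqOn hA hS hu₀ j),
    cycleArea_eq hA hS hu₀]
  rw [integral_sub_const, deliveryTime, deliveryTime, entryTime_succ]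
  ring

theorem intervalIntegrable_age_initial :
    IntervalIntegrable (age u₀ A S) volume 0 (deliveryTime A S 0) := by
  have h : IntervalIntegrable (fun t => t - u₀) volume 0 (deliveryTime A S 0) :=
    Continuous.intervalIntegrable (by fun_prop) _ _
  have h0 : 0 ≤ deliveryTime A S 0 :=
    (entryTime_zero_pos hA).le.trans (entryTime_lt_deliveryTime hS 0).le
  refine h.congr_ae ?_
  rw [Set.uIoc_of_le h0, ← restrict_Ioo_eq_restrict_Ioc]
  refine (ae_restrict_mem measurableSet_Ioo).mono fun t ht => ?_
  rw [age, freshestStamp_eq_initial hA hS ht.2]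

theorem intervalIntegrable_age_deliveryTime (hu₀ : u₀ ≤ 0) (n : ℕ) :
    IntervalIntegrable (age u₀ A S) volume 0 (deliveryTime A S n) := by
  induction n with
  | zero => exact intervalIntegrable_age_initial hA hS
  | succ n ih => exact ih.trans (intervalIntegrable_age_cycle hA hS hu₀ n)

theorem intervalIntegrable_age (hu₀ : u₀ ≤ 0) {τ : ℝ} (hτ : 0 ≤ τ) :
    IntervalIntegrable (age u₀ A S) volume 0 τ := by
  obtain ⟨n, hn⟩ := ((tendsto_deliveryTime hA hS).eventually_ge_atTop τ).exists
  refine (intervalIntegrable_age_deliveryTime hA hS hu₀ n).mono_set ?_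
  rw [Set.uIcc_of_le hτ, Set.uIcc_of_le (hτ.trans hn)]
  exact Set.Icc_subset_Icc_right hn

theorem integral_age_deliveryTime (hu₀ : u₀ ≤ 0) (n : ℕ) :
    ∫ t in (0 : ℝ)..(deliveryTime A S n), age u₀ A S t =
      (∫ t in (0 : ℝ)..(deliveryTime A S 0), age u₀ A S t) - S 0 ^ 2 / 2 +
        ∑ j ∈ Finset.range n, cycleArea u₀ A S j + S n ^ 2 / 2 := by
  induction n with
  | zero => simp
  | succ n ih =>
    rw [← intervalIntegral.integral_add_adjacent_intervals
      (intervalIntegrable_age_deliveryTime hA hS hu₀ n)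
      (intervalIntegrable_age_cycle hA hS hu₀ n), ih, integral_age_cycle hA hS hu₀,
      Finset.sum_range_succ]
    ring

end Path

/-- The n-th term is the difference of two consecutive partial sums, and both of these divided by n
tend to `L`. -/
theorem tendsto_div_of_tendsto_average {a : ℕ → ℝ} {L : ℝ}
    (h : Tendsto (fun n : ℕ => (∑ i ∈ Finset.range n, a i) / n) atTop (𝓝 L)) :
    Tendsto (fun n : ℕ => a n / n) atTop (𝓝 0) := by
  have h1 := h.comp (tendsto_add_atTop_nat 1)
  have h2 : Tendsto (fun n : ℕ => ((n : ℝ) + 1) / n) atTop (𝓝 1) := by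
    have := (tendsto_const_nhds (x := (1 : ℝ))).add (tendsto_one_div_atTop_nhds_zero_nat (𝕜 := ℝ))
    rw [add_zero] at this
    refine this.congr' ?_
    filter_upwards [eventually_gt_atTop 0] with n hn
    have : (n : ℝ) ≠ 0 := by positivity
    field_simp
  have h3 := (h1.mul h2).sub h
  rw [mul_one, sub_self] at h3
  refine h3.congr' ?_
  filter_upwards [eventually_gt_atTop 0] with n hn
  have : (n : ℝ) ≠ 0 := by positivity
  have h4 : ((n : ℝ) + 1) ≠ 0 := by positivity
  simp only [Function.comp_apply, Finset.sum_range_succ]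
  push_cast
  field_simp
  ring

/-- A monotone function whose growth is known along a sequence of linear growth. -/
theorem tendsto_div_of_tendsto_sequence {I : ℝ → ℝ} (hI : MonotoneOn I (Set.Ici 0))
    (hI0 : ∀ τ, 0 ≤ τ → 0 ≤ I τ) {D : ℕ → ℝ} (hD0 : 0 < D 0) (hD : StrictMono D)
    (hDt : Tendsto D atTop atTop) {a b : ℝ} (hb : 0 < b)
    (ha : Tendsto (fun n : ℕ => I (D n) / n) atTop (𝓝 a))
    (hDb : Tendsto (fun n : ℕ => D n / n) atTop (𝓝 b)) :
    Tendsto (fun τ => I τ / τ) atTop (𝓝 (a / b)) := by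
  classical
  have hex : ∀ τ, ∃ n, τ < D n := fun τ => (hDt.eventually_gt_atTop τ).exists
  -- First index with `D` beyond τ. Then I τ / τ lies between the quotients that take numerator and
  -- denominator at opposite ends of the step containing τ, and both tend to a / b.
  set N : ℝ → ℕ := fun τ => Nat.find (hex τ) with hN
  have hlt : ∀ τ, τ < D (N τ) := fun τ => Nat.find_spec (hex τ)
  have hge : ∀ τ, D 0 ≤ τ → 1 ≤ N τ ∧ D (N τ - 1) ≤ τ := fun τ hτ => by
    have h1 : 1 ≤ N τ := by
      by_contra! h
      have := hlt τ
      rw [Nat.lt_one_iff.1 h] at this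
      linarith
    exact ⟨h1, not_lt.1 (Nat.find_min (hex τ) (Nat.sub_lt h1 one_pos))⟩
  have hNt : Tendsto N atTop atTop := by
    refine tendsto_atTop.2 fun m => ?_
    filter_upwards [eventually_ge_atTop (D m)] with τ hτ
    exact (hD.lt_iff_lt.1 (hτ.trans_lt (hlt τ))).le
  have hN1 : Tendsto (fun τ => N τ - 1) atTop atTop := (tendsto_sub_atTop_nat 1).comp hNt
  have hr : Tendsto (fun n : ℕ => ((n - 1 : ℕ) : ℝ) / n) atTop (𝓝 1) := by
    have := (tendsto_const_nhds (x := (1 : ℝ))).sub (tendsto_one_div_atTop_nhds_zero_nat (𝕜 := ℝ))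
    rw [sub_zero] at this
    refine this.congr' ?_
    filter_upwards [eventually_gt_atTop 0] with n hn
    have : (n : ℝ) ≠ 0 := by positivity
    rw [Nat.cast_sub hn]
    field_simp
    simp
  have hDp : ∀ n, 0 < D n := fun n => hD0.trans_le (hD.monotone (Nat.zero_le n))
  have low : Tendsto (fun τ => I (D (N τ - 1)) / D (N τ)) atTop (𝓝 (a / b)) := by
    have h := ((ha.comp hN1).mul (hr.comp hNt)).div (hDb.comp hNt) hb.ne'
    rw [mul_one] at h
    refine h.congr' ?_
    filter_upwards [hNt.eventually_gt_atTop 1] with τ hτ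
    have h1 : (N τ : ℝ) ≠ 0 := by positivity
    have h2 : ((N τ - 1 : ℕ) : ℝ) ≠ 0 := by
      have : 0 < N τ - 1 := by omega
      positivity
    have h3 := (hDp (N τ)).ne'
    simp only [Function.comp_apply, Pi.div_apply]
    field_simp
  have high : Tendsto (fun τ => I (D (N τ)) / D (N τ - 1)) atTop (𝓝 (a / b)) := by
    have h := (ha.comp hNt).div ((hDb.comp hN1).mul (hr.comp hNt)) (by simpa using hb.ne')
    rw [mul_one] at h
    refine h.congr' ?_
    filter_upwards [hNt.eventually_gt_atTop 1] with τ hτ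
    have h1 : (N τ : ℝ) ≠ 0 := by positivity
    have h2 : ((N τ - 1 : ℕ) : ℝ) ≠ 0 := by
      have : 0 < N τ - 1 := by omega
      positivity
    have h3 := (hDp (N τ - 1)).ne'
    simp only [Function.comp_apply, Pi.div_apply]
    field_simp
  refine tendsto_of_tendsto_of_tendsto_of_le_of_le' low high ?_ ?_
  · filter_upwards [eventually_ge_atTop (D 0)] with τ hτ
    have hτ0 := hD0.trans_le hτ
    exact div_le_div₀ (hI0 τ hτ0.le) (hI (hDp _).le hτ0.le (hge τ hτ).2) hτ0 (hlt τ).le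
  · filter_upwards [eventually_ge_atTop (D 0)] with τ hτ
    have hτ0 := hD0.trans_le hτ
    exact div_le_div₀ (hI0 _ (hDp _).le) (hI hτ0.le (hDp _).le (hlt τ).le) (hDp _) (hge τ hτ).2

/-- The time average of the age along a sample path, from the averages over the cycles. -/
theorem tendsto_average_age {A S : ℕ → ℝ} {u₀ : ℝ} (hA : RegularArrivals A) (hS : ∀ j, 0 < S j)
    (hu₀ : u₀ ≤ 0) {a b c : ℝ} (hb : 0 < b)
    (hQ : Tendsto (fun n : ℕ => (∑ j ∈ Finset.range n, cycleArea u₀ A S j) / n) atTop (𝓝 a))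
    (hY : Tendsto (fun n : ℕ => (∑ j ∈ Finset.range n, cycleLength A S j) / n) atTop (𝓝 b))
    (hS2 : Tendsto (fun n : ℕ => (∑ j ∈ Finset.range n, S j ^ 2) / n) atTop (𝓝 c)) :
    Tendsto (fun τ : ℝ => (1 / τ) * ∫ t in (0 : ℝ)..τ, age u₀ A S t) atTop (𝓝 (a / b)) := by
  have h2 := tendsto_div_of_tendsto_average hS2
  have hinv := tendsto_one_div_atTop_nhds_zero_nat (𝕜 := ℝ)
  -- Uses (S n / n)² = (1 / n)(S n² / n), so convergence of the averaged squares suffices.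
  have h1 : Tendsto (fun n : ℕ => S n / n) atTop (𝓝 0) := by
    have := (hinv.mul h2).sqrt
    rw [mul_zero, Real.sqrt_zero] at this
    refine this.congr fun n => ?_
    rw [one_div_mul_eq_div, div_div, ← sq, ← div_pow,
      Real.sqrt_sq (div_nonneg (hS n).le n.cast_nonneg)]
  simp_rw [one_div_mul_eq_div]
  refine tendsto_div_of_tendsto_sequence (D := deliveryTime A S) ?_ ?_
    ((entryTime_zero_pos hA).trans (entryTime_lt_deliveryTime hS 0))
    (deliveryTime_strictMono hA hS) (tendsto_deliveryTime hA hS) hb ?_ ?_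
  · intro x hx y hy hxy
    refine intervalIntegral.integral_mono_interval le_rfl hx hxy ?_
      (intervalIntegrable_age hA hS hu₀ hy)
    exact (ae_restrict_mem measurableSet_Ioc).mono fun t ht => age_nonneg hS hu₀ ht.1.le
  · exact fun τ hτ => intervalIntegral.integral_nonneg hτ fun t ht => age_nonneg hS hu₀ ht.1
  · have h := ((hinv.const_mul ((∫ t in (0 : ℝ)..(deliveryTime A S 0), age u₀ A S t) -
      S 0 ^ 2 / 2)).add hQ).add (h2.div_const 2)
    rw [mul_zero, zero_add, zero_div, add_zero] at h
    refine h.congr fun n => ?_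
    rw [integral_age_deliveryTime hA hS hu₀ n]
    ring
  · have h := ((hinv.const_mul (entryTime A S 0)).add hY).add h1
    rw [mul_zero, zero_add, add_zero] at h
    refine h.congr fun n => ?_
    rw [deliveryTime_eq_sum]
    ring

end GilbertElliot

namespace GilbertElliot

/-! ### Moments of the times of a cycle -/

instance holderTriple_four_four_two : ENNReal.HolderTriple 4 4 2 where
  inv_add_inv_eq_inv := by
    rw [← two_mul, show (4 : ENNReal) = 2 * 2 by norm_num,
      ENNReal.mul_inv (by simp) (by simp), ← mul_assoc, ENNReal.mul_inv_cancel (by simp) (by simp),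
      one_mul]

theorem nextServiceMean_eq (μb μg p q : ℝ) (s : ServerState) : nextServiceMean μb μg p q s =
    ∑ s', transition p q s s' * expMean (serviceRate μb μg s') := by
  rw [sum_serverState]
  cases s <;> simp only [nextServiceMean, transition, serviceRate]
  ring

theorem sum_transition (p q : ℝ) (s : ServerState) : ∑ s', transition p q s s' = 1 := by
  rw [sum_serverState]
  cases s <;> simp [transition]

section Moments

variable {lam μb μg p q : ℝ} (hlam : 0 < lam) (hμb : 0 < μb) (hμg : 0 < μg)

include hlam hμb hμg

theorem memLp_service (s : ServerState) :
    MemLp (fun w : ℝ × ℝ => w.1) 4 (cycleLaw lam μb μg s) := by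
  have := isProbabilityMeasure_expMeasure hlam
  exact (memLp_four_expMeasure (serviceRate_pos hμb hμg s)).comp_measurePreserving
    measurePreserving_fst

theorem memLp_idle (s : ServerState) :
    MemLp (fun w : ℝ × ℝ => w.2) 4 (cycleLaw lam μb μg s) := by
  have := isProbabilityMeasure_expMeasure (serviceRate_pos hμb hμg s)
  have := isProbabilityMeasure_expMeasure hlam
  exact (memLp_four_expMeasure hlam).comp_measurePreserving measurePreserving_snd

theorem memLp_length (s : ServerState) :
    MemLp (fun w : ℝ × ℝ => w.1 + w.2) 4 (cycleLaw lam μb μg s) :=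
  (memLp_service hlam hμb hμg s).add (memLp_idle hlam hμb hμg s)

theorem memLp_length_sq (s : ServerState) :
    MemLp (fun w : ℝ × ℝ => (w.1 + w.2) ^ 2) 2 (cycleLaw lam μb μg s) := by
  have h := (memLp_length hlam hμb hμg s).mul' (memLp_length hlam hμb hμg s) (r := 2)
  simpa only [sq] using h

theorem memLp_service_sq (s : ServerState) :
    MemLp (fun w : ℝ × ℝ => w.1 ^ 2) 2 (cycleLaw lam μb μg s) := by
  have h := (memLp_service hlam hμb hμg s).mul' (memLp_service hlam hμb hμg s) (r := 2)
  simpa only [sq] using h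

theorem memLp_length_two (s : ServerState) :
    MemLp (fun w : ℝ × ℝ => w.1 + w.2) 2 (cycleLaw lam μb μg s) := by
  have := isProbabilityMeasure_cycleLaw hlam hμb hμg s
  exact (memLp_length hlam hμb hμg s).mono_exponent (by norm_num)

theorem integrable_service (s : ServerState) :
    Integrable (fun w : ℝ × ℝ => w.1) (cycleLaw lam μb μg s) := by
  have := isProbabilityMeasure_cycleLaw hlam hμb hμg s
  exact (memLp_service hlam hμb hμg s).integrable (by norm_num)

theorem integrable_length (s : ServerState) :
    Integrable (fun w : ℝ × ℝ => w.1 + w.2) (cycleLaw lam μb μg s) := by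
  have := isProbabilityMeasure_cycleLaw hlam hμb hμg s
  exact (memLp_length hlam hμb hμg s).integrable (by norm_num)

theorem integral_service (s : ServerState) :
    ∫ w : ℝ × ℝ, w.1 ∂(cycleLaw lam μb μg s) = expMean (serviceRate μb μg s) := by
  have := isProbabilityMeasure_expMeasure (serviceRate_pos hμb hμg s)
  have := isProbabilityMeasure_expMeasure hlam
  rw [integral_fun_fst (fun x : ℝ => x)]
  simp [expMean]

theorem integral_length (s : ServerState) :
    ∫ w : ℝ × ℝ, (w.1 + w.2) ∂(cycleLaw lam μb μg s) = meanLength lam μb μg s := by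
  have := isProbabilityMeasure_expMeasure (serviceRate_pos hμb hμg s)
  have := isProbabilityMeasure_expMeasure hlam
  rw [integral_add (integrable_service hlam hμb hμg s)
    ((memLp_idle hlam hμb hμg s).integrable (by norm_num)), integral_service hlam hμb hμg,
    integral_fun_snd (fun x : ℝ => x)]
  simp [expMean, meanLength]

theorem meanLength_pos (s : ServerState) : 0 < meanLength lam μb μg s :=
  add_pos (expMean_pos (serviceRate_pos hμb hμg s)) (expMean_pos hlam)

/-- The observable is the area minus its conditional mean given the state and times of its cycle; as
a product of two L⁴ variables it lies in L². -/
theorem memLp_pair_centered (s s' : ServerState) :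
    MemLp (fun z : (ℝ × ℝ) × (ℝ × ℝ) => (z.1.1 + z.1.2) * (z.2.1 - nextServiceMean μb μg p q s)) 2
      ((cycleLaw lam μb μg s).prod (cycleLaw lam μb μg s')) := by
  have := fun s => isProbabilityMeasure_cycleLaw hlam hμb hμg s
  have h1 := (memLp_length hlam hμb hμg s).comp_measurePreserving
    (measurePreserving_fst (ν := cycleLaw lam μb μg s'))
  have h2 := ((memLp_service hlam hμb hμg s').sub
    (memLp_const (nextServiceMean μb μg p q s))).comp_measurePreserving
      (measurePreserving_snd (μ := cycleLaw lam μb μg s))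
  exact h2.mul' h1

/-- Expected area of a cycle given the times of the cycle. -/
noncomputable def expectedArea (μb μg p q : ℝ) (s : ServerState) (w : ℝ × ℝ) : ℝ :=
  1 / 2 * (w.1 + w.2) ^ 2 + (w.1 + w.2) * nextServiceMean μb μg p q s

theorem memLp_expectedArea (s : ServerState) :
    MemLp (expectedArea μb μg p q s) 2 (cycleLaw lam μb μg s) :=
  ((memLp_length_sq hlam hμb hμg s).const_mul _).add
    ((memLp_length_two hlam hμb hμg s).mul_const _)

theorem integral_expectedArea (s : ServerState) :
    ∫ w, expectedArea μb μg p q s w ∂(cycleLaw lam μb μg s) = meanArea lam μb μg p q s := by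
  have := isProbabilityMeasure_cycleLaw hlam hμb hμg s
  unfold expectedArea
  rw [integral_add (((memLp_length_sq hlam hμb hμg s).integrable (by norm_num)).const_mul _)
    ((integrable_length hlam hμb hμg s).mul_const _), integral_const_mul, integral_mul_const,
    integral_length hlam hμb hμg]
  rfl

end Moments

/-! ### Laws of large numbers -/

/-- Pair observables are centered through their second cycle, so limits are obtained for the shifted
sequence; one initial term does not affect them. -/
theorem tendsto_average_of_shift {a : ℕ → ℝ} {L : ℝ}
    (h : Tendsto (fun n : ℕ => (∑ i ∈ Finset.range n, a (i + 1)) / n) atTop (𝓝 L)) :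
    Tendsto (fun n : ℕ => (∑ i ∈ Finset.range n, a i) / n) atTop (𝓝 L) := by
  rw [← tendsto_add_atTop_iff_nat 1]
  have h1 : Tendsto (fun n : ℕ => (n : ℝ) / (n + 1)) atTop (𝓝 1) :=
    tendsto_natCast_div_add_atTop 1
  have h2 := (tendsto_one_div_add_atTop_nhds_zero_nat (𝕜 := ℝ)).const_mul (a 0)
  have h3 := (h.mul h1).add h2
  rw [mul_one, mul_zero, add_zero] at h3
  refine h3.congr' ?_
  filter_upwards [eventually_gt_atTop 0] with n hn
  rw [Finset.sum_range_succ']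
  push_cast
  field_simp

variable {Ω : Type*} [MeasurableSpace Ω] {P : Measure Ω}
  {lam μb μg p q : ℝ} {A : ℕ → Ω → ℝ} {X : ℕ → Ω → ServerState} {S : ℕ → Ω → ℝ}

namespace IsModel

variable (hM : IsModel P lam μb μg p q A X S) [IsProbabilityMeasure P]
  (hlam : 0 < lam) (hμb : 0 < μb) (hμg : 0 < μg)
  (hp : p ∈ Set.Ioo (0 : ℝ) 1) (hq : q ∈ Set.Ioo (0 : ℝ) 1)

include hM hlam hμb hμg hp hq

/-- Ergodic theorem for the chain of server states. -/
theorem tendsto_average_state : ∀ᵐ ω ∂P, ∀ v : ServerState → ℝ,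
    Tendsto (fun n : ℕ => (∑ i ∈ Finset.range n, v (X i ω)) / n) atTop
      (𝓝 ((q * v .bad + p * v .good) / (p + q))) := by
  have := fun s => isProbabilityMeasure_cycleLaw hlam hμb hμg s
  set x : ServerState → ℝ := fun s => match s with
    | .bad => 0
    | .good => 1 with hx
  have h := hM.tendsto_average_pairValue_zero hlam hμb hμg hp hq
    (F := fun s s' _ _ => x s' - transition p q s .good) (fun _ _ => measurable_const)
    (fun _ _ => memLp_const _) fun s w => by
      simp only [integral_const, probReal_univ, one_smul]
      rw [sum_serverState]
      cases s <;> simp only [hx, transition] <;> ring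
  have hpq : 0 < p + q := add_pos hp.1 hq.1
  filter_upwards [h] with ω hω v
  have hinv := tendsto_one_div_atTop_nhds_zero_nat (𝕜 := ℝ)
  have hx1 : ∀ s, |x s| ≤ 1 := fun s => by cases s <;> simp [hx]
  have htel : Tendsto (fun n : ℕ => (x (X n ω) - x (X 0 ω)) / n) atTop (𝓝 0) := by
    have h2 := hinv.const_mul 2
    rw [mul_zero] at h2
    refine squeeze_zero_norm (fun n => ?_) h2
    rw [Real.norm_eq_abs, abs_div, Nat.abs_cast, mul_one_div]
    gcongr
    exact (abs_sub _ _).trans (by linarith [hx1 (X n ω), hx1 (X 0 ω)])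
  -- On two states every function is affine in the indicator `x`. It is written around the function
  -- (p + q)x - p, whose average vanishes, so a single null set serves all `v`.
  have hv : ∀ s, v s = (v .good - v .bad) / (p + q) * ((p + q) * x s - p) +
      (q * v .bad + p * v .good) / (p + q) := fun s => by
    cases s <;> simp only [hx] <;> field_simp <;> ring
  have htr : ∀ s, transition p q s .good = x s - ((p + q) * x s - p) := fun s => by
    cases s <;> simp only [hx, transition] <;> ring
  -- The centered increment equals the telescoping difference of `x` plus (p + q)x - p.
  have hlim : Tendsto (fun n : ℕ => (∑ i ∈ Finset.range n, ((p + q) * x (X i ω) - p)) / n) atTop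
      (𝓝 0) := by
    have := hω.sub htel
    rw [sub_zero] at this
    refine this.congr fun n => ?_
    rw [← Finset.sum_range_sub (fun i => x (X i ω)), ← sub_div, ← Finset.sum_sub_distrib]
    congr 1
    refine Finset.sum_congr rfl fun i _ => ?_
    simp only [pairValue, htr]
    ring
  have := (hlim.const_mul ((v .good - v .bad) / (p + q))).add
    (tendsto_const_nhds (x := (q * v .bad + p * v .good) / (p + q)))
  rw [mul_zero, zero_add] at this
  refine this.congr' ?_
  filter_upwards [eventually_gt_atTop 0] with n hn
  have hn' : (n : ℝ) ≠ 0 := by positivity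
  rw [Finset.sum_congr rfl fun i _ => hv (X i ω), Finset.sum_add_distrib, ← Finset.mul_sum,
    Finset.sum_const, Finset.card_range, nsmul_eq_mul,
    show ∀ a b : ℝ, (a + n * b) / n = a / n + b from fun a b => by field_simp, mul_div_assoc]

/-- Ergodic theorem for square integrable functions of a state and the times of its cycle. -/
theorem tendsto_average_cycle {h : ServerState → ℝ × ℝ → ℝ} (hm : ∀ s, Measurable (h s))
    (h2 : ∀ s, MemLp (h s) 2 (cycleLaw lam μb μg s)) :
    ∀ᵐ ω ∂P, Tendsto (fun n : ℕ =>
      (∑ i ∈ Finset.range n, h (X i ω) (cycleTimes A S i ω)) / n) atTop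
      (𝓝 ((q * ∫ w, h .bad w ∂(cycleLaw lam μb μg .bad) +
        p * ∫ w, h .good w ∂(cycleLaw lam μb μg .good)) / (p + q))) := by
  have := fun s => isProbabilityMeasure_cycleLaw hlam hμb hμg s
  set v : ServerState → ℝ := fun s => ∫ w, h s w ∂(cycleLaw lam μb μg s) with hv
  -- Centering by the mean given the next state makes the conditional mean vanish for each next
  -- state separately.
  have h0 := hM.tendsto_average_pairValue_zero hlam hμb hμg hp hq
    (F := fun _ s' _ w' => h s' w' - v s')
    (fun _ s' => ((hm s').comp measurable_snd).sub_const _)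
    (fun s s' => ((h2 s').sub (memLp_const _)).comp_measurePreserving
      (measurePreserving_snd (μ := cycleLaw lam μb μg s))) fun s w => by
      refine Finset.sum_eq_zero fun s' _ => ?_
      rw [integral_sub ((h2 s').integrable (by norm_num)) (integrable_const _)]
      simp [hv]
  filter_upwards [h0, hM.tendsto_average_state hlam hμb hμg hp hq] with ω h1 h3
  have h4 := (tendsto_average_of_shift
    (a := fun i => h (X i ω) (cycleTimes A S i ω) - v (X i ω)) h1).add (h3 v)
  rw [zero_add] at h4
  refine h4.congr fun n => ?_
  rw [← add_div, ← Finset.sum_add_distrib]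
  simp

/-- Area of a cycle as a function of the times of this cycle and of the next one. -/
theorem tendsto_average_area :
    ∀ᵐ ω ∂P, Tendsto (fun n : ℕ => (∑ i ∈ Finset.range n,
      (1 / 2 * (S i ω + idleTime (A · ω) (S · ω) i) ^ 2 +
        (S i ω + idleTime (A · ω) (S · ω) i) * S (i + 1) ω : ℝ)) / (n : ℝ)) atTop
      (𝓝 ((q * meanArea lam μb μg p q .bad + p * meanArea lam μb μg p q .good) / (p + q))) := by
  have := fun s => isProbabilityMeasure_cycleLaw hlam hμb hμg s
  -- Only the next service time is centered here; the remainder `expectedArea` depends on a single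
  -- cycle.
  have h1 := hM.tendsto_average_pairValue_zero hlam hμb hμg hp hq
    (F := fun s _ w w' => (w.1 + w.2) * (w'.1 - nextServiceMean μb μg p q s))
    (fun _ _ => by fun_prop) (memLp_pair_centered hlam hμb hμg) fun s w => by
      have : ∀ s', ∫ w' : ℝ × ℝ, (w.1 + w.2) * (w'.1 - nextServiceMean μb μg p q s)
          ∂(cycleLaw lam μb μg s') = (w.1 + w.2) *
            (expMean (serviceRate μb μg s') - nextServiceMean μb μg p q s) := fun s' => by
        rw [integral_const_mul, integral_sub (integrable_service hlam hμb hμg s')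
          (integrable_const _), integral_service hlam hμb hμg]
        simp
      have hsum : ∑ s', transition p q s s' *
          ((w.1 + w.2) * (expMean (serviceRate μb μg s') - nextServiceMean μb μg p q s)) =
          (w.1 + w.2) * (∑ s', transition p q s s' * expMean (serviceRate μb μg s') -
            (∑ s', transition p q s s') * nextServiceMean μb μg p q s) := by
        rw [Finset.sum_mul, ← Finset.sum_sub_distrib, Finset.mul_sum]
        exact Finset.sum_congr rfl fun _ _ => by ring
      simp_rw [this]
      rw [hsum, ← nextServiceMean_eq, sum_transition]
      ring
  have h2 := hM.tendsto_average_cycle hlam hμb hμg hp hq (h := expectedArea μb μg p q)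
    (fun s => by unfold expectedArea; fun_prop) (memLp_expectedArea hlam hμb hμg)
  simp_rw [integral_expectedArea hlam hμb hμg] at h2
  filter_upwards [h1, h2] with ω h1 h2
  have h3 := h1.add h2
  rw [zero_add] at h3
  refine h3.congr fun n => ?_
  rw [← add_div, ← Finset.sum_add_distrib]
  congr 1
  refine Finset.sum_congr rfl fun i _ => ?_
  simp only [pairValue, expectedArea, cycleTimes]
  ring

end IsModel

end GilbertElliot

namespace GilbertElliot

/-! ### Means of the area and of the length of a cycle -/

/-- Area of a cycle as a function of the times of this cycle and of the next one. -/
noncomputable def areaObservable : PairObservable := fun _ _ w w' =>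
  1 / 2 * (w.1 + w.2) ^ 2 + (w.1 + w.2) * w'.1

/-- Length of a cycle as a function of the times of the cycle. -/
noncomputable def lengthObservable : PairObservable := fun _ _ w _ => w.1 + w.2

theorem measurable_areaObservable (s s' : ServerState) :
    Measurable fun z : (ℝ × ℝ) × (ℝ × ℝ) => areaObservable s s' z.1 z.2 := by
  unfold areaObservable
  fun_prop

theorem measurable_lengthObservable (s s' : ServerState) :
    Measurable fun z : (ℝ × ℝ) × (ℝ × ℝ) => lengthObservable s s' z.1 z.2 := by
  unfold lengthObservable
  fun_prop

theorem cycleLength_eq_pairValue {Ω : Type*} (A : ℕ → Ω → ℝ) (X : ℕ → Ω → ServerState) (S : ℕ → Ω → ℝ)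
    (j : ℕ) (ω : Ω) :
    cycleLength (A · ω) (S · ω) j = pairValue A X S lengthObservable j ω :=
  cycleLength_eq _ _ j

section Moments

variable {lam μb μg : ℝ} (hlam : 0 < lam) (hμb : 0 < μb) (hμg : 0 < μg)

include hlam hμb hμg

theorem integrable_half_length_sq (s s' : ServerState) :
    Integrable (fun z : (ℝ × ℝ) × (ℝ × ℝ) => 1 / 2 * (z.1.1 + z.1.2) ^ 2)
      ((cycleLaw lam μb μg s).prod (cycleLaw lam μb μg s')) := by
  have := fun s => isProbabilityMeasure_cycleLaw hlam hμb hμg s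
  exact (((memLp_length_sq hlam hμb hμg s).integrable (by norm_num)).comp_fst _).const_mul _

theorem integrable_length_mul_service (s s' : ServerState) :
    Integrable (fun z : (ℝ × ℝ) × (ℝ × ℝ) => (z.1.1 + z.1.2) * z.2.1)
      ((cycleLaw lam μb μg s).prod (cycleLaw lam μb μg s')) := by
  have := fun s => isProbabilityMeasure_cycleLaw hlam hμb hμg s
  exact (integrable_length hlam hμb hμg s).mul_prod (integrable_service hlam hμb hμg s')

theorem integrable_areaObservable (s s' : ServerState) :
    Integrable (fun z : (ℝ × ℝ) × (ℝ × ℝ) => areaObservable s s' z.1 z.2)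
      ((cycleLaw lam μb μg s).prod (cycleLaw lam μb μg s')) :=
  (integrable_half_length_sq hlam hμb hμg s s').add
    (integrable_length_mul_service hlam hμb hμg s s')

theorem integrable_lengthObservable (s s' : ServerState) :
    Integrable (fun z : (ℝ × ℝ) × (ℝ × ℝ) => lengthObservable s s' z.1 z.2)
      ((cycleLaw lam μb μg s).prod (cycleLaw lam μb μg s')) := by
  have := fun s => isProbabilityMeasure_cycleLaw hlam hμb hμg s
  exact (integrable_length hlam hμb hμg s).comp_fst _

theorem integral_areaObservable (s s' : ServerState) :
    ∫ z : (ℝ × ℝ) × (ℝ × ℝ), areaObservable s s' z.1 z.2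
      ∂((cycleLaw lam μb μg s).prod (cycleLaw lam μb μg s')) =
      1 / 2 * sumSecondMoment (serviceRate μb μg s) lam +
        meanLength lam μb μg s * expMean (serviceRate μb μg s') := by
  have := fun s => isProbabilityMeasure_cycleLaw hlam hμb hμg s
  unfold areaObservable
  rw [integral_add (integrable_half_length_sq hlam hμb hμg s s')
    (integrable_length_mul_service hlam hμb hμg s s'),
    integral_prod_mul (fun w : ℝ × ℝ => w.1 + w.2) (fun w : ℝ × ℝ => w.1),
    integral_length hlam hμb hμg, integral_service hlam hμb hμg,
    integral_fun_fst (fun w : ℝ × ℝ => 1 / 2 * (w.1 + w.2) ^ 2), integral_const_mul]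
  simp [sumSecondMoment]

theorem integral_lengthObservable (s s' : ServerState) :
    ∫ z : (ℝ × ℝ) × (ℝ × ℝ), lengthObservable s s' z.1 z.2
      ∂((cycleLaw lam μb μg s).prod (cycleLaw lam μb μg s')) = meanLength lam μb μg s := by
  have := fun s => isProbabilityMeasure_cycleLaw hlam hμb hμg s
  unfold lengthObservable
  rw [integral_fun_fst (fun w : ℝ × ℝ => w.1 + w.2), integral_length hlam hμb hμg]
  simp

end Moments

theorem meanArea_eq_sum (lam μb μg p q : ℝ) (s : ServerState) :
    ∑ s', transition p q s s' * (1 / 2 * sumSecondMoment (serviceRate μb μg s) lam +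
      meanLength lam μb μg s * expMean (serviceRate μb μg s')) = meanArea lam μb μg p q s := by
  have h : ∑ s', transition p q s s' * (1 / 2 * sumSecondMoment (serviceRate μb μg s) lam +
      meanLength lam μb μg s * expMean (serviceRate μb μg s')) =
      (∑ s', transition p q s s') * (1 / 2 * sumSecondMoment (serviceRate μb μg s) lam) +
        meanLength lam μb μg s * ∑ s', transition p q s s' * expMean (serviceRate μb μg s') := by
    rw [Finset.sum_mul, Finset.mul_sum, ← Finset.sum_add_distrib]
    exact Finset.sum_congr rfl fun _ _ => by ring
  rw [h, sum_transition, one_mul, ← nextServiceMean_eq]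
  rfl

variable {Ω : Type*} [MeasurableSpace Ω] {P : Measure Ω}
  {lam μb μg p q : ℝ} {A : ℕ → Ω → ℝ} {X : ℕ → Ω → ServerState} {S : ℕ → Ω → ℝ}

namespace IsModel

/-- The area formula needs a regular path, so it holds only almost surely, unlike the identity for
the length. -/
theorem ae_cycleArea_eq (hM : IsModel P lam μb μg p q A X S) [IsProbabilityMeasure P]
    (hlam : 0 < lam) {u₀ : ℝ} (hu₀ : u₀ ≤ 0) :
    ∀ᵐ ω ∂P, ∀ j, cycleArea u₀ (A · ω) (S · ω) j = pairValue A X S areaObservable j ω := by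
  filter_upwards [hM.ae_regular hlam, hM.ae_service_pos] with ω hA hS j
  exact cycleArea_eq hA hS hu₀ j

theorem stationary_state (hM : IsModel P lam μb μg p q A X S) [IsProbabilityMeasure P]
    (hlam : 0 < lam) (hμb : 0 < μb) (hμg : 0 < μg)
    (hp : p ∈ Set.Ioo (0 : ℝ) 1) (hq : q ∈ Set.Ioo (0 : ℝ) 1)
    (hb : P.real {ω | X 0 ω = .bad} = q / (p + q)) (hg : P.real {ω | X 0 ω = .good} = p / (p + q))
    (n : ℕ) : P.real {ω | X n ω = .bad} = q / (p + q) ∧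
      P.real {ω | X n ω = .good} = p / (p + q) := by
  have hpq : p + q ≠ 0 := (add_pos hp.1 hq.1).ne'
  induction n with
  | zero => exact ⟨hb, hg⟩
  | succ n ih =>
    have key : ∀ s', P.real {ω | X (n + 1) ω = s'} =
        ∑ s, P.real {ω | X n ω = s} * transition p q s s' := fun s' => by
      have h : P {ω | X (n + 1) ω = s'} =
          ∑ s, P {ω | X n ω = s} * ENNReal.ofReal (transition p q s s') := by
        conv_lhs => rw [← hM.sum_restrict_state n]
        rw [Measure.finsetSum_apply]
        refine Finset.sum_congr rfl fun s _ => ?_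
        rw [← hM.measure_states hlam hμb hμg, Measure.restrict_apply (hM.measurableSet_state _ _),
          Set.inter_comm]
        rfl
      rw [Measure.real, h, ENNReal.toReal_sum fun s _ =>
        ENNReal.mul_ne_top (measure_ne_top _ _) ENNReal.ofReal_ne_top]
      refine Finset.sum_congr rfl fun s _ => ?_
      rw [ENNReal.toReal_mul, ENNReal.toReal_ofReal (transition_pos hp hq s s').le]
      rfl
    rw [key, key, sum_serverState, sum_serverState, ih.1, ih.2]
    simp only [transition]
    constructor <;> field_simp <;> ring

section Means

variable (hM : IsModel P lam μb μg p q A X S) [IsProbabilityMeasure P]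
  (hlam : 0 < lam) (hμb : 0 < μb) (hμg : 0 < μg)
  (hp : p ∈ Set.Ioo (0 : ℝ) 1) (hq : q ∈ Set.Ioo (0 : ℝ) 1)

include hM hlam hμb hμg hp hq

theorem integral_cond_pairValue {F : PairObservable} {s s' : ServerState}
    (hF : Measurable fun z : (ℝ × ℝ) × (ℝ × ℝ) => F s s' z.1 z.2) (n : ℕ)
    (hs : P {ω | X n ω = s} ≠ 0) :
    ∫ ω, pairValue A X S F n ω ∂P[|{ω | X n ω = s ∧ X (n + 1) ω = s'}] =
      ∫ z : (ℝ × ℝ) × (ℝ × ℝ), F s s' z.1 z.2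
        ∂((cycleLaw lam μb μg s).prod (cycleLaw lam μb μg s')) := by
  -- Conditioning on a null event would give the zero measure; positive transition probabilities
  -- exclude this.
  have h0 : P {ω | X n ω = s ∧ X (n + 1) ω = s'} ≠ 0 := by
    rw [hM.measure_states hlam hμb hμg]
    exact mul_ne_zero hs (by simpa using transition_pos hp hq s s')
  have h1 : P.real {ω | X n ω = s ∧ X (n + 1) ω = s'} ≠ 0 :=
    ENNReal.toReal_ne_zero.2 ⟨h0, measure_ne_top _ _⟩
  rw [ProbabilityTheory.cond, integral_smul_measure, hM.setIntegral_pairValue hlam hμb hμg hF,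
    ENNReal.toReal_inv, smul_eq_mul]
  exact inv_mul_cancel_left₀ h1 _

theorem integral_pairValue_eq_sum {F : PairObservable}
    (hFm : ∀ s s', Measurable fun z : (ℝ × ℝ) × (ℝ × ℝ) => F s s' z.1 z.2)
    (hF : ∀ s s', Integrable (fun z : (ℝ × ℝ) × (ℝ × ℝ) => F s s' z.1 z.2)
      ((cycleLaw lam μb μg s).prod (cycleLaw lam μb μg s'))) (n : ℕ) :
    ∫ ω, pairValue A X S F n ω ∂P = ∑ s, P.real {ω | X n ω = s} * ∑ s', transition p q s s' *
      ∫ z : (ℝ × ℝ) × (ℝ × ℝ), F s s' z.1 z.2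
        ∂((cycleLaw lam μb μg s).prod (cycleLaw lam μb μg s')) := by
  rw [hM.integral_pairValue hlam hμb hμg hFm hF]
  refine Finset.sum_congr rfl fun s _ => ?_
  rw [Finset.mul_sum]
  refine Finset.sum_congr rfl fun s' _ => ?_
  rw [Measure.real, hM.measure_states hlam hμb hμg, ENNReal.toReal_mul,
    ENNReal.toReal_ofReal (transition_pos hp hq s s').le, mul_assoc]
  rfl

end Means

end IsModel

theorem averageAge_eq {lam μb μg p q : ℝ} (hpq : 0 < p + q) : averageAge lam μb μg p q =
    ((q * meanArea lam μb μg p q .bad + p * meanArea lam μb μg p q .good) / (p + q)) /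
      ((q * meanLength lam μb μg .bad + p * meanLength lam μb μg .good) / (p + q)) := by
  rw [div_div_div_cancel_right₀ hpq.ne', averageAge]

end GilbertElliot

/-! ### The theorem -/

open GilbertElliot in
theorem mainTheorem1 {Ω : Type*} [MeasurableSpace Ω] (P : Measure Ω) [IsProbabilityMeasure P]
    (lam μb μg p q u₀ : ℝ) (hlam : 0 < lam) (hμb : 0 < μb) (hμ : μb < μg)
    (hp : p ∈ Set.Ioo (0 : ℝ) 1) (hq : q ∈ Set.Ioo (0 : ℝ) 1) (hu₀ : u₀ ≤ 0)
    (A : ℕ → Ω → ℝ) (X : ℕ → Ω → ServerState) (S : ℕ → Ω → ℝ)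
    (hM : IsModel P lam μb μg p q A X S) :
    -- the time average of the age
    (∀ᵐ ω ∂P,
      (∀ τ, 0 ≤ τ → IntervalIntegrable (age u₀ (A · ω) (S · ω)) volume 0 τ) ∧
      Tendsto (fun τ : ℝ => (1 / τ) * ∫ t in (0 : ℝ)..τ, age u₀ (A · ω) (S · ω) t)
        atTop (𝓝 (averageAge lam μb μg p q))) ∧
    -- the ratio of the average area and the average length of the cycles
    (∀ᵐ ω ∂P,
      Tendsto (fun n : ℕ =>
          ((1 / (n : ℝ)) * ∑ j ∈ Finset.range n, cycleArea u₀ (A · ω) (S · ω) j) /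
          ((1 / (n : ℝ)) * ∑ j ∈ Finset.range n, cycleLength (A · ω) (S · ω) j))
        atTop (𝓝 (averageAge lam μb μg p q))) ∧
    -- area and length of a cycle have finite means
    (∀ j, Integrable (fun ω => cycleArea u₀ (A · ω) (S · ω) j) P ∧
      Integrable (fun ω => cycleLength (A · ω) (S · ω) j) P) ∧
    -- conditional means of area and length, given the state of the server in the cycle
    (∀ j s, P {ω | X j ω = s} ≠ 0 →
      transition p q s .bad *
          (∫ ω, cycleArea u₀ (A · ω) (S · ω) j ∂P[|{ω | X j ω = s ∧ X (j + 1) ω = .bad}]) +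
        transition p q s .good *
          (∫ ω, cycleArea u₀ (A · ω) (S · ω) j ∂P[|{ω | X j ω = s ∧ X (j + 1) ω = .good}]) =
        meanArea lam μb μg p q s ∧
      (∀ s', ∫ ω, cycleLength (A · ω) (S · ω) j ∂P[|{ω | X j ω = s ∧ X (j + 1) ω = s'}] =
        meanLength lam μb μg s)) ∧
    -- the ratio of the means, if the chain of server states is stationary
    (P {ω | X 0 ω = .bad} = ENNReal.ofReal (q / (p + q)) →
      P {ω | X 0 ω = .good} = ENNReal.ofReal (p / (p + q)) →
      ∀ j, (∫ ω, cycleArea u₀ (A · ω) (S · ω) j ∂P) / (∫ ω, cycleLength (A · ω) (S · ω) j ∂P) =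
        averageAge lam μb μg p q) := by
  have hμg : 0 < μg := hμb.trans hμ
  have hpq : 0 < p + q := add_pos hp.1 hq.1
  have hlen : 0 < (q * meanLength lam μb μg .bad + p * meanLength lam μb μg .good) / (p + q) :=
    div_pos (add_pos (mul_pos hq.1 (meanLength_pos hlam hμb hμg _))
      (mul_pos hp.1 (meanLength_pos hlam hμb hμg _))) hpq
  have harea := hM.ae_cycleArea_eq hlam hu₀
  have hQ : ∀ᵐ ω ∂P, Tendsto (fun n : ℕ =>
      (∑ j ∈ Finset.range n, cycleArea u₀ (A · ω) (S · ω) j) / n) atTop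
      (𝓝 ((q * meanArea lam μb μg p q .bad + p * meanArea lam μb μg p q .good) / (p + q))) := by
    filter_upwards [hM.tendsto_average_area hlam hμb hμg hp hq, harea] with ω h1 h2
    simp_rw [h2]
    exact h1
  have hY : ∀ᵐ ω ∂P, Tendsto (fun n : ℕ =>
      (∑ j ∈ Finset.range n, cycleLength (A · ω) (S · ω) j) / n) atTop
      (𝓝 ((q * meanLength lam μb μg .bad + p * meanLength lam μb μg .good) / (p + q))) := by
    have h := hM.tendsto_average_cycle hlam hμb hμg hp hq (h := fun _ w => w.1 + w.2)
      (fun _ => by fun_prop) (memLp_length_two hlam hμb hμg)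
    simp_rw [integral_length hlam hμb hμg] at h
    filter_upwards [h] with ω hω
    simp_rw [cycleLength_eq]
    exact hω
  have hS2 := hM.tendsto_average_cycle hlam hμb hμg hp hq (h := fun _ w => w.1 ^ 2)
    (fun _ => by fun_prop) (memLp_service_sq hlam hμb hμg)
  have hareaj : ∀ j, (fun ω => cycleArea u₀ (A · ω) (S · ω) j) =ᵐ[P]
      pairValue A X S areaObservable j := fun j => harea.mono fun ω h => h j
  have hlengthj : ∀ j, (fun ω => cycleLength (A · ω) (S · ω) j) =
      pairValue A X S lengthObservable j := fun j =>
    funext fun ω => cycleLength_eq_pairValue A X S j ω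
  rw [averageAge_eq hpq]
  refine ⟨?_, ?_, fun j => ⟨?_, ?_⟩, fun j s hs => ⟨?_, fun s' => ?_⟩, fun hb hg j => ?_⟩
  · filter_upwards [hM.ae_regular hlam, hM.ae_service_pos, hQ, hY, hS2] with ω hA hS h1 h2 h3
    exact ⟨fun τ hτ => intervalIntegrable_age hA hS hu₀ hτ,
      tendsto_average_age hA hS hu₀ hlen h1 h2 h3⟩
  · filter_upwards [hQ, hY] with ω h1 h2
    simp_rw [one_div_mul_eq_div]
    exact h1.div h2 hlen.ne'
  · exact (hM.integrable_pairValue hlam hμb hμg (integrable_areaObservable hlam hμb hμg) j).congr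
      (hareaj j).symm
  · rw [hlengthj]
    exact hM.integrable_pairValue hlam hμb hμg (integrable_lengthObservable hlam hμb hμg) j
  · have h : ∀ s', ∫ ω, cycleArea u₀ (A · ω) (S · ω) j
        ∂P[|{ω | X j ω = s ∧ X (j + 1) ω = s'}] =
        1 / 2 * sumSecondMoment (serviceRate μb μg s) lam +
          meanLength lam μb μg s * expMean (serviceRate μb μg s') := fun s' => by
      -- Conditioning preserves null sets, so the almost sure area formula remains valid.
      rw [integral_congr_ae (cond_absolutelyContinuous.ae_eq (hareaj j)),
        hM.integral_cond_pairValue hlam hμb hμg hp hq (measurable_areaObservable s s') j hs,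
        integral_areaObservable hlam hμb hμg]
    rw [h, h, ← meanArea_eq_sum, sum_serverState]
  · rw [hlengthj, hM.integral_cond_pairValue hlam hμb hμg hp hq
      (measurable_lengthObservable s s') j hs, integral_lengthObservable hlam hμb hμg]
  · obtain ⟨h1, h2⟩ := hM.stationary_state hlam hμb hμg hp hq
      (by rw [Measure.real, hb, ENNReal.toReal_ofReal (div_nonneg hq.1.le hpq.le)])
      (by rw [Measure.real, hg, ENNReal.toReal_ofReal (div_nonneg hp.1.le hpq.le)]) j
    rw [integral_congr_ae (hareaj j), hlengthj,
      hM.integral_pairValue_eq_sum hlam hμb hμg hp hq measurable_areaObservable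
        (integrable_areaObservable hlam hμb hμg),
      hM.integral_pairValue_eq_sum hlam hμb hμg hp hq measurable_lengthObservable
        (integrable_lengthObservable hlam hμb hμg)]
    -- Averaging over the next state leaves the means weighted by the law of the present state,
    -- which is stationary; the common factor p + q cancels.
    simp_rw [integral_areaObservable hlam hμb hμg, integral_lengthObservable hlam hμb hμg,
      meanArea_eq_sum, ← Finset.sum_mul, sum_transition, one_mul]
    rw [sum_serverState, sum_serverState, h1, h2]
    congr 1 <;> ring
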